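/- Let $p$ be a prime. A symplectic pair is an element $a=(a_1,a_2)\in\mathbb F_p^2$ (it stands for the generalized Pauli matrix $X^{a_1}Z^{a_2}$), and $\langle a,b\rangle=a_1b_2-a_2b_1$. Finite Pauli operators on the lattice $\mathbb Z^3$, up to phases, are finitely supported functions $\mathbb Z^3\to\mathbb F_p^2$; two of them commute iff the sum over all sites of the symplectic products of their values vanishes. For symplectic pairs $\alpha,\beta,\gamma,\delta$ let $\mathcal C^{\alpha\beta\gamma\delta}_S$ (resp. $\mathcal C^{\alpha\beta\gamma\delta}_A$) be the stabilizer code on $\mathbb Z^3$ with one generator on each unit cube: its labels on the face $x=1$ are $\alpha,\beta,\gamma,\delta$ at $(y,z)=(0,1),(1,1),(0,0),(1,0)$, and the corner antipodal to a corner labelled $A$ is labelled $A$ (resp. $-A$). Put $T_{AC}=\begin{pmatrix}A_1&-A_2\\C_1&-C_2\end{pmatrix}$ and $T^{BD}_{AC}=T_{BD}^{-1}T_{AC}$. Suppose * $\langle A,B\rangle\ne0$ for any two different labels $A,B$ among $\alpha,\beta,\gamma,\delta$; * $\det(T-T^{-1})\neq0$ for $T=T^{\gamma\beta}_{\delta\alpha},\,T^{\delta\gamma}_{\alpha\beta},\,T^{\gamma\beta}_{\alpha\delta}$;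 * $\langle A,B\rangle^2\ne\langle C,D\rangle^2$ whenever $A,B,C,D$ are the four labels in some order. Then, for either code, the following hold. 1. Consider a strip along a coordinate axis, consisting of $l$ consecutive layers orthogonal to that axis and having as cross section $w$ sites which form either a straight segment or two perpendicular segments meeting at a corner (a flat strip, or a strip with one corner, of width $w$ and length $l$). If a Pauli operator $O$ supported on the strip is different from the identity and commutes with every generator that acts only on these $l$ layers, then $l\le 2w$. 2. Consequently the code has no string logical operator. Precisely, let $\Omega_1,\Omega_2$ be two cubes of $w^3$ sites, with lowest corners $a$ and $b$, and let $O$ be a finite Pauli operator that commutes with every generator acting trivially on both cubes (a logical string segment of width $w$). Suppose it is nontrivial: for every $O'$ obtained from $O$ by multiplying by finitely many generators and their inverses there are $p_1\in\Omega_1$, $p_2\in\Omega_2$ joined by a path in $\mathrm{supp}(O')\cup\{p_1,p_2\}$ in which consecutive sites are acted on nontrivially by a common generator. Then $|b_i-a_i|\le 5w$ for $i=1,2,3$; in particular its length $\sum_i|b_i-a_i|$ is at most $15w$. -/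

import Mathlib

namespace CubicCode

/-- A symplectic pair over `𝔽_p`; the pair `(a₁, a₂)` represents the generalized Pauli matrix
`X ^ a₁ * Z ^ a₂` of a `p`-dimensional qudit, up to a phase. -/
abbrev Pair (p : ℕ) : Type := ZMod p × ZMod p

/-- The symplectic product `⟨a, b⟩ = a₁ b₂ - a₂ b₁`. -/
def symp {p : ℕ} (a b : Pair p) : ZMod p := a.1 * b.2 - a.2 * b.1

/-- `T_{a c}`: the `2 × 2` matrix with rows `(a₁, -a₂)` and `(c₁, -c₂)`. -/
def rowMat {p : ℕ} (a c : Pair p) : Matrix (Fin 2) (Fin 2) (ZMod p) :=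
  !![a.1, -a.2; c.1, -c.2]

/-- The transition matrix `T_{a c}^{b d} = (T_{b d})⁻¹ T_{a c}`, written `transition b d a c`
(upper indices first). -/
noncomputable def transition {p : ℕ} [Fact p.Prime] (b d a c : Pair p) : Matrix (Fin 2) (Fin 2) (ZMod p) :=
  (rowMat b d)⁻¹ * rowMat a c

/-- Deformability: the four labels have pairwise nonzero symplectic products. -/
def Deformable {p : ℕ} (α β γ δ : Pair p) : Prop :=
  ∀ i j : Fin 4, i ≠ j → symp (![α, β, γ, δ] i) (![α, β, γ, δ] j) ≠ 0

/-- Absence of minimal strings: `det (T - T⁻¹) ≠ 0` for the three transition matrices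
`T^{γβ}_{δα}`, `T^{δγ}_{αβ}`, `T^{γβ}_{αδ}`. -/
def NoMinimalString {p : ℕ} [Fact p.Prime] (α β γ δ : Pair p) : Prop :=
  (transition γ β δ α - (transition γ β δ α)⁻¹).det ≠ 0 ∧
  (transition δ γ α β - (transition δ γ α β)⁻¹).det ≠ 0 ∧
  (transition γ β α δ - (transition γ β α δ)⁻¹).det ≠ 0

/-- `⟨A, B⟩² ≠ ⟨C, D⟩²` whenever `A, B, C, D` are the four labels in some order. -/
def SquaresDiffer {p : ℕ} (α β γ δ : Pair p) : Prop :=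
  ∀ σ : Equiv.Perm (Fin 4),
    symp (![α, β, γ, δ] (σ 0)) (![α, β, γ, δ] (σ 1)) ^ 2 ≠
      symp (![α, β, γ, δ] (σ 2)) (![α, β, γ, δ] (σ 3)) ^ 2

/-- Sites of the cubic lattice. -/
abbrev Site : Type := Fin 3 → ℤ

/-- A finite Pauli operator up to a phase: a finitely supported assignment of symplectic pairs.
Multiplication of operators is addition of assignments. -/
abbrev Pauli (p : ℕ) : Type := Site →₀ Pair p

/-- Two Pauli operators commute iff the sum over all sites of their symplectic products
vanishes. -/
def Commutes {p : ℕ} (P Q : Pauli p) : Prop :=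
  (P.sum fun s a => symp a (Q s)) = 0

/-- The two families of codes: symmetric and antisymmetric under inversion of the cube. -/
inductive Family
  | symmetric
  | antisymmetric

/-- The factor relating the labels at two antipodal corners of the cube. -/
def Family.sign (p : ℕ) : Family → ZMod p
  | .symmetric => 1
  | .antisymmetric => -1

/-- The labels of the generator at the corners `(x, y, z)` of the unit cube. The labels
`α, β, γ, δ` occupy the face `x = 1`, arranged (`y` to the right, `z` upwards) as
```
α β
γ δ
```
and the corner antipodal to one labelled `A` is labelled `A` (symmetric family) or `-A`
(antisymmetric family). -/
def cornerLabel {p : ℕ} (κ : Family) (α β γ δ : Pair p) : Fin 2 → Fin 2 → Fin 2 → Pair p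
  | 1, 0, 1 => α
  | 1, 1, 1 => β
  | 1, 0, 0 => γ
  | 1, 1, 0 => δ
  | 0, 1, 0 => κ.sign p • α
  | 0, 0, 0 => κ.sign p • β
  | 0, 1, 1 => κ.sign p • γ
  | 0, 0, 1 => κ.sign p • δ

/-- The stabilizer generator on the unit cube with lowest corner `c`. -/
noncomputable def gen {p : ℕ} (κ : Family) (α β γ δ : Pair p) (c : Site) : Pauli p :=
  ∑ b : Fin 3 → Fin 2,
    Finsupp.single (fun i => c i + ((b i : ℕ) : ℤ)) (cornerLabel κ α β γ δ (b 0) (b 1) (b 2))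

/-- A family of stabilizer generators, one for each unit cube (indexed by its lowest corner). The
code `C_S^{αβγδ}` or `C_A^{αβγδ}` is given by the family `gen κ α β γ δ`. -/
abbrev Generators (p : ℕ) : Type := Site → Pauli p

/-- The stabilizer group, up to phases: all finite products of generators and inverses. -/
noncomputable def stabilizer {p : ℕ} (g : Generators p) : AddSubgroup (Pauli p) :=
  AddSubgroup.closure (Set.range g)

/-- The operator `P` acts trivially on every site of `Ω`. -/
def TrivialOn {p : ℕ} (P : Pauli p) (Ω : Set Site) : Prop := ∀ s ∈ Ω, P s = 0

/-- `(O, Ω₁, Ω₂)` is logical: every generator that acts trivially on both `Ω₁` and `Ω₂`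
commutes with `O`. -/
def IsLogical {p : ℕ} (g : Generators p) (O : Pauli p) (Ω₁ Ω₂ : Set Site) : Prop :=
  ∀ c : Site, TrivialOn (g c) Ω₁ → TrivialOn (g c) Ω₂ → Commutes (g c) O

/-- Some generator acts nontrivially on `s` and `t` simultaneously. -/
def Linked {p : ℕ} (g : Generators p) (s t : Site) : Prop :=
  ∃ c : Site, g c s ≠ 0 ∧ g c t ≠ 0

/-- There is a path in `M` joining `s` and `t`. -/
def JoinedIn {p : ℕ} (g : Generators p) (M : Set Site) (s t : Site) : Prop :=
  s ∈ M ∧ Relation.ReflTransGen (fun u v => v ∈ M ∧ Linked g u v) s t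

/-- `(O, Ω₁, Ω₂)` is connected: some `p₁ ∈ Ω₁` and `p₂ ∈ Ω₂` are joined by a path in
`supp O ∪ {p₁, p₂}`. -/
def IsConnectedSegment {p : ℕ} (g : Generators p) (O : Pauli p) (Ω₁ Ω₂ : Set Site) : Prop :=
  ∃ p₁ ∈ Ω₁, ∃ p₂ ∈ Ω₂, JoinedIn g ((O.support : Set Site) ∪ {p₁, p₂}) p₁ p₂

/-- A segment is nontrivial if every equivalent segment is connected; equivalent segments are
obtained by multiplying `O` by finitely many generators. -/
def IsNontrivial {p : ℕ} (g : Generators p) (O : Pauli p) (Ω₁ Ω₂ : Set Site) : Prop :=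
  ∀ O' : Pauli p, O' - O ∈ stabilizer g → IsConnectedSegment g O' Ω₁ Ω₂

/-- The cube of `w ^ 3` sites with lowest corner `a`. -/
def cube (a : Site) (w : ℕ) : Set Site := {s | ∀ i, a i ≤ s i ∧ s i < a i + w}

/-- The `l₁`-length of the vector from `a` to `b`. -/
def l1Length (a b : Site) : ℤ := ∑ i, |b i - a i|

/-- `S` is a lattice strip of width `w` and length `l` along the axis `d`, starting at the layer
`k` (so it occupies the layers `k, …, k + l - 1`). Its cross section consists of `w` sites: two
perpendicular straight arms, with `m + 1` and `n + 1` sites, meeting at the corner `q`. For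
`n = 0` (or `m = 0`) the strip is flat. -/
def IsStrip (d : Fin 3) (k : ℤ) (w l : ℕ) (S : Set Site) : Prop :=
  ∃ (q : Site) (e f : Fin 3) (s t : ℤ) (m n : ℕ),
    d ≠ e ∧ d ≠ f ∧ e ≠ f ∧ |s| = 1 ∧ |t| = 1 ∧ m + n + 1 = w ∧ q d = k ∧
    S = {x | ∃ j < l,
      (∃ i ≤ m, x = q + Pi.single d (j : ℤ) + Pi.single e (s * i)) ∨
      (∃ i ≤ n, x = q + Pi.single d (j : ℤ) + Pi.single f (t * i))}

/-- All sites before the layer `k` along the axis `d`. -/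
def before (d : Fin 3) (k : ℤ) : Set Site := {x | x d < k}

/-- All sites from the layer `k` on, along the axis `d`. -/
def beyond (d : Fin 3) (k : ℤ) : Set Site := {x | k ≤ x d}

end CubicCode

/-! Part 1. Along the strip, the values of `O` form sequences on which `X` acts as the shift. Each
unit square meeting the cross section then gives one linear equation over `K[X]`, whose coefficients
are the pencils `u + X v` of labels on the four cube edges along the strip. Peeling the cross
section from the tip of its first arm to the tip of the second uses all equations but the two beyond
the last tip, and shows that one polynomial of degree at most `2w` kills every value
(`bend_smul_eq_zero`). A finite strip can be prolonged to infinite sequences obeying these same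
equations (`exists_squareSum_eq`). The two equations left out define sequences that are killed by
the same polynomial and, if `l > 2w`, begin with at least `2w` zeros; hence they vanish too. Peeling
now also works from the opposite tip, with other quadratic polynomials. These are coprime to the
former ones, so everything is zero (`StripLabels.eq_zero_of_long`).

Coprimality comes from the antipodal symmetry: opposite edges carry reversed pencils, which puts a
nonzero multiple of `1 - X ^ 2` into the ideal of the two polynomials, while the determinant
conditions say that neither `1` nor `-1` is a root.

Part 2. Suppose that the anchors are more than `5w` apart along an axis `d`. Since antipodal labels
are proportional, a value allowed by one cube can be cancelled by the opposite cube and pushed along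
a diagonal (`CubeLabels.exists_sweep`). This confines the operator, on the near side of the far
anchor, to a column of cross section `w × w`, and then, between the anchors, to two sides of that
column: a strip with one corner, of width `2w - 1`. It has more than `4w` layers, so Part 1 clears
it. The resulting gap cannot be crossed by a path, as generators have diameter one in each
coordinate. -/

namespace CubicCode

/-! ### Peeling a bent cross section, over an arbitrary commutative ring -/

section Pairing

variable {R M : Type*} [CommRing R] [AddCommGroup M] [Module R M]

/-- The symplectic product of two vectors over a commutative ring. -/
def area (r s : R × R) : R := r.1 * s.2 - r.2 * s.1

/-- The symplectic pairing of a vector of scalars with a vector of module elements. -/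
def pairing (r : R × R) (u : M × M) : M := r.1 • u.2 - r.2 • u.1

@[simp] theorem pairing_zero (r : R × R) : pairing r (0 : M × M) = 0 := by simp [pairing]

theorem smul_pairing (a : R) (r : R × R) (u : M × M) : a • pairing r u = pairing r (a • u) := by
  simp only [pairing, Prod.smul_fst, Prod.smul_snd]
  module

/-- Cramer's rule: two equations for `u` determine it up to the determinant `area r s`. Each peeling
step is an instance of this. -/
theorem area_smul_eq_zero {a : R} {r s : R × R} {u : M × M} (hr : a • pairing r u = 0)
    (hs : a • pairing s u = 0) : (a * area r s) • u = 0 := by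
  have h1 : (a * area r s) • u.1 = s.1 • a • pairing r u - r.1 • a • pairing s u := by
    simp only [pairing, area]; module
  have h2 : (a * area r s) • u.2 = s.2 • a • pairing r u - r.2 • a • pairing s u := by
    simp only [pairing, area]; module
  ext
  · simp only [Prod.smul_fst, h1, hr, hs, smul_zero, sub_zero, Prod.fst_zero]
  · simp only [Prod.smul_snd, h2, hr, hs, smul_zero, sub_zero, Prod.snd_zero]

theorem area_smul_eq_zero' {r s : R × R} {u : M × M} (hr : pairing r u = 0)
    (hs : pairing s u = 0) : area r s • u = 0 := by
  rw [← one_mul (area r s)]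
  exact area_smul_eq_zero (by rw [hr, smul_zero]) (by rw [hs, smul_zero])

theorem eq_zero_of_isCoprime_smul {N : Type*} [AddCommGroup N] [Module R N] {a b : R} {u : N}
    (h : IsCoprime a b) (ha : a • u = 0) (hb : b • u = 0) : u = 0 := by
  obtain ⟨x, y, hxy⟩ := h
  rw [← one_smul R u, ← hxy, add_smul, mul_smul, mul_smul, ha, hb, smul_zero, smul_zero, add_zero]

/-- The sum of the pairings of the four vectors `r` with the values of `V` at the corners of the
unit square with lowest corner `(i, j)`. -/
def squareSum (r : Fin 2 → Fin 2 → R × R) (V : ℤ → ℤ → M × M) (i j : ℤ) : M :=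
  pairing (r 0 0) (V i j) + pairing (r 1 0) (V (i + 1) j) + pairing (r 0 1) (V i (j + 1)) +
    pairing (r 1 1) (V (i + 1) (j + 1))

theorem smul_squareSum (a : R) (r : Fin 2 → Fin 2 → R × R) (V : ℤ → ℤ → M × M) (i j : ℤ) :
    a • squareSum r V i j = squareSum r (fun i j => a • V i j) i j := by
  simp only [squareSum, smul_add, smul_pairing]

/-- Two perpendicular arms with `m + 1` and `n + 1` sites meeting at the origin. -/
def InBend (m n : ℕ) (i j : ℤ) : Prop := (j = 0 ∧ 0 ≤ i ∧ i ≤ m) ∨ (i = 0 ∧ 0 ≤ j ∧ j ≤ n)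

/-- All unit squares meeting the bent segment, apart from the two squares beyond the end of the
second arm, sum to zero. -/
def BendEquations (r : Fin 2 → Fin 2 → R × R) (V : ℤ → ℤ → M × M) (m n : ℕ) : Prop :=
  (∀ i : ℤ, 1 ≤ i → i ≤ m → squareSum r V i 0 = 0 ∧ squareSum r V i (-1) = 0) ∧
  (∀ j : ℤ, 0 ≤ j → j ≤ n → squareSum r V (-1) (j - 1) = 0 ∧ squareSum r V 0 (j - 1) = 0)

variable {r : Fin 2 → Fin 2 → R × R} {V : ℤ → ℤ → M × M} {m n : ℕ}

/-- Peeling from the tip towards the corner: the site `i` meets its outer neighbour in the squares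
`(i, 0)` and `(i, -1)`, where it carries `r 0 0` and `r 0 1`. Each step costs one factor `area (r 0
0) (r 0 1)`. -/
theorem first_arm_smul_eq_zero (hV : ∀ i j, ¬ InBend m n i j → V i j = 0)
    (hE : BendEquations r V m n) (k : ℕ) (hk : k < m) :
    (area (r 0 0) (r 0 1) ^ (k + 1)) • V (m - k) 0 = 0 := by
  induction k with
  | zero =>
    obtain ⟨h1, h2⟩ := hE.1 (m - (0 : ℕ)) (by omega) (by omega)
    have e1 : V ((m : ℤ) - (0 : ℕ) + 1) 0 = 0 := hV _ _ (by unfold InBend; omega)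
    have e2 : V ((m : ℤ) - (0 : ℕ) + 1) (-1) = 0 := hV _ _ (by unfold InBend; omega)
    have e3 : V ((m : ℤ) - (0 : ℕ)) (-1) = 0 := hV _ _ (by unfold InBend; omega)
    have e4 : V ((m : ℤ) - (0 : ℕ)) (0 + 1) = 0 := hV _ _ (by unfold InBend; omega)
    have e5 : V ((m : ℤ) - (0 : ℕ) + 1) (0 + 1) = 0 := hV _ _ (by unfold InBend; omega)
    simp only [squareSum, e1, e4, e5, pairing_zero, add_zero] at h1
    simp only [squareSum, e1, e2, e3, neg_add_cancel, pairing_zero, add_zero, zero_add] at h2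
    rw [zero_add, pow_one]
    exact area_smul_eq_zero' h1 h2
  | succ k ih =>
    obtain ⟨h1, h2⟩ := hE.1 (m - (k + 1 : ℕ)) (by omega) (by omega)
    have ih := ih (by omega)
    have e0 : (m : ℤ) - (k + 1 : ℕ) + 1 = m - k := by push_cast; ring
    have e2 : V ((m : ℤ) - k) (-1) = 0 := hV _ _ (by unfold InBend; omega)
    have e3 : V ((m : ℤ) - (k + 1 : ℕ)) (-1) = 0 := hV _ _ (by unfold InBend; omega)
    have e4 : V ((m : ℤ) - (k + 1 : ℕ)) (0 + 1) = 0 := hV _ _ (by unfold InBend; omega)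
    have e5 : V ((m : ℤ) - k) (0 + 1) = 0 := hV _ _ (by unfold InBend; omega)
    simp only [squareSum, e0, e4, e5, pairing_zero, add_zero] at h1
    simp only [squareSum, e0, e2, e3, neg_add_cancel, pairing_zero, add_zero, zero_add] at h2
    rw [pow_succ]
    refine area_smul_eq_zero ?_ ?_
    · rw [eq_neg_of_add_eq_zero_left h1, smul_neg, smul_pairing, ih, pairing_zero, neg_zero]
    · rw [eq_neg_of_add_eq_zero_left h2, smul_neg, smul_pairing, ih, pairing_zero, neg_zero]

/-- Peeling goes on from the corner outwards. The squares below the site `j` attach `r 0 1` and `r 1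
1` to it; the neighbour of the corner on the first arm enters as well, but is already killed by the
first factor. -/
theorem second_arm_smul_eq_zero (hV : ∀ i j, ¬ InBend m n i j → V i j = 0)
    (hE : BendEquations r V m n) (k : ℕ) (hk : k ≤ n) :
    (area (r 0 0) (r 0 1) ^ m * area (r 0 1) (r 1 1) ^ (k + 1)) • V 0 k = 0 := by
  have hone : ∀ j, (area (r 0 0) (r 0 1) ^ m) • V 1 j = 0 := by
    intro j
    by_cases hb : InBend m n 1 j
    · have hj : j = 0 := by unfold InBend at hb; omega
      have hm : 1 ≤ m := by unfold InBend at hb; omega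
      have := first_arm_smul_eq_zero hV hE (m - 1) (by omega)
      rw [Nat.sub_add_cancel hm] at this
      rw [hj]
      convert this using 3
      omega
    · rw [hV _ _ hb, smul_zero]
  have hneg : ∀ j, V (-1) j = 0 := fun j => hV _ _ (by unfold InBend; omega)
  induction k with
  | zero =>
    obtain ⟨h1, h2⟩ := hE.2 0 le_rfl (by omega)
    have e1 : V 0 (-1) = 0 := hV _ _ (by unfold InBend; omega)
    simp only [squareSum, hneg, e1, zero_sub, neg_add_cancel, pairing_zero, zero_add] at h1
    simp only [squareSum, e1, zero_sub, neg_add_cancel, pairing_zero, zero_add] at h2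
    rw [pow_one]
    refine area_smul_eq_zero ?_ ?_
    · rw [add_assoc, add_comm, add_assoc, add_eq_zero_iff_eq_neg] at h2
      rw [Nat.cast_zero, h2, smul_neg, smul_add, smul_pairing, smul_pairing, hone, hone,
        pairing_zero, pairing_zero, add_zero, neg_zero]
    · rw [Nat.cast_zero, h1, smul_zero]
  | succ k ih =>
    obtain ⟨h1, h2⟩ := hE.2 (k + 1) (by omega) (by omega)
    have ih := ih (by omega)
    have hone' : ∀ j, (area (r 0 0) (r 0 1) ^ m * area (r 0 1) (r 1 1) ^ (k + 1)) • V 1 j = 0 := by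
      intro j
      rw [mul_comm, mul_smul, hone, smul_zero]
    simp only [squareSum, hneg, neg_add_cancel, pairing_zero, zero_add, add_zero,
      add_sub_cancel_right] at h1
    simp only [squareSum, zero_add, add_sub_cancel_right] at h2
    rw [pow_succ _ (k + 1), ← mul_assoc]
    rw [Nat.cast_succ]
    refine area_smul_eq_zero ?_ ?_
    · have : pairing (r 0 1) (V 0 (k + 1)) = - (pairing (r 0 0) (V 0 k) + pairing (r 1 0) (V 1 k)
          + pairing (r 1 1) (V 1 (k + 1))) := by
        rw [← sub_eq_zero, ← h2]; abel
      rw [this, smul_neg, smul_add, smul_add, smul_pairing, smul_pairing, smul_pairing, hone',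
        hone', ih, pairing_zero, pairing_zero, pairing_zero, add_zero, add_zero, neg_zero]
    · rw [eq_neg_of_add_eq_zero_right h1, smul_neg, smul_pairing, ih, pairing_zero, neg_zero]

theorem bend_smul_eq_zero (hV : ∀ i j, ¬ InBend m n i j → V i j = 0)
    (hE : BendEquations r V m n) (i j : ℤ) :
    (area (r 0 0) (r 0 1) ^ m * area (r 0 1) (r 1 1) ^ (n + 1)) • V i j = 0 := by
  by_cases hb : InBend m n i j
  · by_cases hi : i = 0
    · have hj : 0 ≤ j ∧ j ≤ n := by unfold InBend at hb; omega
      lift j to ℕ using hj.1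
      obtain ⟨c, hc⟩ : ∃ c, n + 1 = j + 1 + c := ⟨n - j, by omega⟩
      rw [hc, pow_add, ← mul_assoc, mul_comm, mul_smul, hi,
        second_arm_smul_eq_zero hV hE j (by omega), smul_zero]
    · have hj : j = 0 ∧ 1 ≤ i ∧ i ≤ m := by unfold InBend at hb; omega
      obtain ⟨c, hc⟩ : ∃ c : ℕ, (m : ℤ) = i + c := ⟨(m - i).toNat, by omega⟩
      obtain ⟨c', hc'⟩ : ∃ c' : ℕ, m = c' + (c + 1) := ⟨(i - 1).toNat, by omega⟩
      have := first_arm_smul_eq_zero hV hE c (by omega)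
      rw [show (m : ℤ) - c = i by omega] at this
      rw [hj.1, mul_comm, mul_smul, show area (r 0 0) (r 0 1) ^ m =
        area (r 0 0) (r 0 1) ^ c' * area (r 0 0) (r 0 1) ^ (c + 1) by rw [← pow_add, ← hc'],
        mul_smul, this, smul_zero, smul_zero]
  · rw [hV _ _ hb, smul_zero]

/-- With the two equations beyond the second tip, peeling can run backwards. At each site the values
peeled before are exactly zero, so the site is killed by `area (r 0 0) (r 1 0)` or `area (r 1 0) (r
1 1)`, and by the coprime polynomial of the forward peeling. -/
theorem bend_eq_zero (hV : ∀ i j, ¬ InBend m n i j → V i j = 0) (hE : BendEquations r V m n)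
    (h1 : squareSum r V (-1) n = 0) (h2 : squareSum r V 0 n = 0)
    (c1 : IsCoprime (area (r 0 0) (r 1 0)) (area (r 0 0) (r 0 1)))
    (c2 : IsCoprime (area (r 0 0) (r 1 0)) (area (r 0 1) (r 1 1)))
    (c3 : IsCoprime (area (r 1 0) (r 1 1)) (area (r 0 0) (r 0 1)))
    (c4 : IsCoprime (area (r 1 0) (r 1 1)) (area (r 0 1) (r 1 1))) (i j : ℤ) : V i j = 0 := by
  have hE2 : ∀ j : ℤ, 0 ≤ j → j ≤ n → squareSum r V (-1) j = 0 ∧ squareSum r V 0 j = 0 := by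
    intro j hj hjn
    rcases hjn.lt_or_eq with h | h
    · simpa using hE.2 (j + 1) (by omega) (by omega)
    · rw [h]; exact ⟨h1, h2⟩
  have hneg : ∀ j, V (-1) j = 0 := fun j => hV _ _ (by unfold InBend; omega)
  have hsecond : ∀ k : ℕ, k ≤ n → V 0 ((n : ℤ) + 1 - k) = 0 := by
    intro k
    induction k with
    | zero => intro _; exact hV _ _ (by unfold InBend; omega)
    | succ k ih =>
      intro hk
      obtain ⟨e1, e2⟩ := hE2 ((n : ℤ) + 1 - (k + 1 : ℕ)) (by omega) (by omega)
      have e0 : (n : ℤ) + 1 - (k + 1 : ℕ) + 1 = n + 1 - k := by push_cast; ring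
      have e3 : V 1 ((n : ℤ) + 1 - (k + 1 : ℕ)) = 0 := hV _ _ (by unfold InBend; omega)
      have e4 : V 1 ((n : ℤ) + 1 - k) = 0 := hV _ _ (by unfold InBend; omega)
      simp only [squareSum, hneg, neg_add_cancel, e0, ih (by omega), pairing_zero, zero_add,
        add_zero] at e1
      simp only [squareSum, e0, ih (by omega), pairing_zero, zero_add, e3, e4, add_zero] at e2
      refine eq_zero_of_isCoprime_smul (IsCoprime.mul_right c1.pow_right c2.pow_right) ?_
        (bend_smul_eq_zero hV hE _ _)
      exact area_smul_eq_zero' e2 e1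
  have hfirst : ∀ k : ℕ, k ≤ m + 1 → V ((k : ℤ) - 1) 0 = 0 := by
    have hone : V 0 1 = 0 := by
      rcases Nat.eq_zero_or_pos n with h | h
      · exact hV _ _ (by unfold InBend; omega)
      · simpa using hsecond n le_rfl
    intro k
    induction k with
    | zero => intro _; exact hV _ _ (by unfold InBend; omega)
    | succ k ih =>
      intro hk
      have e0 : ((k + 1 : ℕ) : ℤ) - 1 = k - 1 + 1 := by push_cast; ring
      rw [e0]
      have e : squareSum r V ((k : ℤ) - 1) 0 = 0 ∧ squareSum r V ((k : ℤ) - 1) (-1) = 0 := by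
        -- The squares at `i = k - 1 ≥ 1` belong to the first arm; those at `i = -1` and `i = 0` are
        -- supplied by the equations of the second arm.
        rcases Nat.lt_or_ge 1 k with h | h
        · exact hE.1 _ (by omega) (by omega)
        · rcases Nat.eq_zero_or_pos k with h' | h'
          · subst h'
            exact ⟨by simpa using (hE2 0 le_rfl (by omega)).1,
              by simpa using (hE.2 0 le_rfl (by omega)).1⟩
          · have : k = 1 := by omega
            subst this
            exact ⟨by simpa using (hE2 0 le_rfl (by omega)).2,
              by simpa using (hE.2 0 le_rfl (by omega)).2⟩
      have d1 : ∀ i, V i 1 = 0 := by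
        intro i
        by_cases hi : i = 0
        · rw [hi, hone]
        · exact hV _ _ (by unfold InBend; omega)
      have d2 : ∀ i, V i (-1) = 0 := fun i => hV _ _ (by unfold InBend; omega)
      obtain ⟨e1, e2⟩ := e
      simp only [squareSum, zero_add, d1, ih (by omega), pairing_zero, add_zero] at e1
      simp only [squareSum, d2, ih (by omega), neg_add_cancel, pairing_zero, zero_add] at e2
      refine eq_zero_of_isCoprime_smul (IsCoprime.mul_right c3.pow_right c4.pow_right) ?_
        (bend_smul_eq_zero hV hE _ _)
      exact area_smul_eq_zero' e1 e2
  by_cases hb : InBend m n i j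
  · by_cases hj : j = 0
    · have := hfirst (i + 1).toNat (by unfold InBend at hb; omega)
      rw [show ((i + 1).toNat : ℤ) - 1 = i by unfold InBend at hb; omega] at this
      rw [hj, this]
    · have := hsecond (n + 1 - j).toNat (by unfold InBend at hb; omega)
      rw [show (n : ℤ) + 1 - (n + 1 - j).toNat = j by unfold InBend at hb; omega] at this
      rw [show i = 0 by unfold InBend at hb; omega, this]
  · exact hV _ _ hb

end Pairing

/-! ### Sequences as modules over polynomials in the shift -/

section Sequences

open Polynomial

variable (K : Type*) [Field K]

/-- Sequences with values in a field, as a module over polynomials in the shift. -/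
def ShiftSeq : Type _ := ℕ → K

instance : AddCommGroup (ShiftSeq K) := inferInstanceAs (AddCommGroup (ℕ → K))

instance : Module K (ShiftSeq K) := inferInstanceAs (Module K (ℕ → K))

/-- The shift operator. -/
def shift : Module.End K (ShiftSeq K) where
  toFun u := fun x => u (x + 1)
  map_add' _ _ := rfl
  map_smul' _ _ := rfl

noncomputable instance : Module K[X] (ShiftSeq K) :=
  Module.compHom _ (aeval (shift K)).toRingHom

variable {K}

@[ext]
theorem ShiftSeq.ext {F : Type*} {u v : ShiftSeq F} (h : ∀ x, u x = v x) : u = v := funext h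

@[simp] theorem ShiftSeq.zero_apply (x : ℕ) : (0 : ShiftSeq K) x = 0 := rfl

@[simp] theorem ShiftSeq.add_apply (u v : ShiftSeq K) (x : ℕ) : (u + v) x = u x + v x := rfl

@[simp] theorem ShiftSeq.sub_apply (u v : ShiftSeq K) (x : ℕ) : (u - v) x = u x - v x := rfl

theorem ShiftSeq.C_smul_apply (a : K) (u : ShiftSeq K) (x : ℕ) : ((C a : K[X]) • u) x = a * u x := by
  change (aeval (shift K) (C a) u) x = _
  rw [aeval_C]
  rfl

theorem ShiftSeq.X_smul_apply (u : ShiftSeq K) (x : ℕ) : ((X : K[X]) • u) x = u (x + 1) := by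
  change (aeval (shift K) X u) x = _
  rw [aeval_X]
  rfl

theorem ShiftSeq.X_pow_smul_apply (k : ℕ) (u : ShiftSeq K) (x : ℕ) :
    ((X : K[X]) ^ k • u) x = u (x + k) := by
  induction k generalizing x with
  | zero => simp
  | succ k ih => rw [pow_succ', mul_smul, X_smul_apply, ih, add_assoc, add_comm 1]

theorem ShiftSeq.sum_apply {ι : Type*} (s : Finset ι) (f : ι → ShiftSeq K) (x : ℕ) :
    (∑ i ∈ s, f i) x = ∑ i ∈ s, f i x := Finset.sum_apply x s f

theorem ShiftSeq.smul_apply (P : K[X]) (u : ShiftSeq K) (x : ℕ) :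
    (P • u) x = ∑ k ∈ Finset.range (P.natDegree + 1), P.coeff k * u (x + k) := by
  conv_lhs => rw [P.as_sum_range_C_mul_X_pow, Finset.sum_smul, sum_apply]
  exact Finset.sum_congr rfl fun k _ => by rw [mul_smul, C_smul_apply, X_pow_smul_apply]

/-- `P` is a linear recurrence: its leading coefficient is invertible, so each term is determined by
the preceding `P.natDegree` ones. -/
theorem ShiftSeq.eq_zero_of_smul_eq_zero {P : K[X]} (hP : P ≠ 0) {u : ShiftSeq K} (h : P • u = 0)
    (h0 : ∀ x < P.natDegree, u x = 0) : u = 0 := by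
  ext x
  induction x using Nat.strong_induction_on with
  | _ x ih =>
    rcases lt_or_ge x P.natDegree with hx | hx
    · exact h0 x hx
    · have := congrArg (fun v : ShiftSeq K => v (x - P.natDegree)) h
      simp only [smul_apply, ShiftSeq.zero_apply] at this
      rw [Finset.sum_range_succ, Finset.sum_eq_zero, zero_add, Nat.sub_add_cancel hx] at this
      · exact (mul_eq_zero.1 this).resolve_left (leadingCoeff_ne_zero.2 hP)
      · intro k hk
        rw [ih _ (by rw [Finset.mem_range] at hk; omega), ShiftSeq.zero_apply, mul_zero]

end Sequences

/-! ### Coprimality of areas of pencils -/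

section Pencils

open Polynomial

variable {K : Type*} [Field K]

/-- The pencil `u + X v` of vectors. -/
noncomputable def pencil (u v : K × K) : K[X] × K[X] := (C u.1 + X * C v.1, C u.2 + X * C v.2)

theorem area_swap {R : Type*} [CommRing R] (r s : R × R) : area r s = -area s r := by
  simp only [area]; ring

theorem area_zero {R : Type*} [CommRing R] (r : R × R) : area r 0 = 0 := by
  simp [area]

theorem area_pencil_smul_right (a : K) (r : K[X] × K[X]) (u v : K × K) :
    area r (pencil (a • u) (a • v)) = C a * area r (pencil u v) := by
  simp only [area, pencil, Prod.smul_fst, Prod.smul_snd, smul_eq_mul, map_mul]; ring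

theorem area_pencil_smul_left (a : K) (r : K[X] × K[X]) (u v : K × K) :
    area (pencil (a • u) (a • v)) r = C a * area (pencil u v) r := by
  simp only [area, pencil, Prod.smul_fst, Prod.smul_snd, smul_eq_mul, map_mul]; ring

theorem eval_one_area_pencil (a b c d : K × K) :
    (area (pencil a b) (pencil c d)).eval 1 = area (a + b) (c + d) := by
  simp [area, pencil]

theorem eval_neg_one_area_pencil (a b c d : K × K) :
    (area (pencil a b) (pencil c d)).eval (-1) = area (a - b) (c - d) := by
  simp [area, pencil, sub_eq_add_neg]

theorem natDegree_area_pencil_le (a b c d : K × K) :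
    (area (pencil a b) (pencil c d)).natDegree ≤ 2 := by
  simp only [area, pencil]
  compute_degree

/-- A common factor would divide `(1 - X) (1 + X)`, hence vanish at `1` or `-1`. The argument also
covers characteristic two. -/
theorem isCoprime_of_combination {P Q S T : K[X]} {c : K} (hc : c ≠ 0)
    (h : (1 - X ^ 2) * C c = S * P + T * Q) (h1 : P.eval 1 ≠ 0) (h2 : P.eval (-1) ≠ 0) :
    IsCoprime P Q := by
  have key : ∀ a : K, P.eval a ≠ 0 → IsCoprime P (X - C a) := fun a ha =>
    ((irreducible_X_sub_C a).coprime_iff_not_dvd.2 (by rwa [dvd_iff_isRoot])).symm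
  have h3 : IsCoprime P ((1 - X ^ 2) * C c) := by
    have e : (1 - X ^ 2) * C c = (X - C 1) * (X - C (-1)) * C (-c) := by
      simp only [map_one, map_neg]; ring
    rw [e]
    rw [isCoprime_mul_unit_right_right (isUnit_C.2 (neg_ne_zero.2 hc).isUnit)]
    exact (key _ h1).mul_right (key _ h2)
  rw [h, add_comm, IsCoprime.add_mul_right_right_iff] at h3
  exact h3.of_mul_right_right

theorem isCoprime_area_pencil_reverse_right {a b c d : K × K} (hab : area a b ≠ 0)
    (hcd : area c d ≠ 0) (h1 : area (a + b) (c + d) ≠ 0) (h2 : area (a - b) (c - d) ≠ 0) :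
    IsCoprime (area (pencil a b) (pencil c d)) (area (pencil a b) (pencil d c)) := by
  -- The Plücker relation for `a + X b`, `b`, `c + X d`, `d + X c`. Its right side is the product of
  -- `area (a + X b) b = area a b` and `area (c + X d) (d + X c) = (1 - X ^ 2) area c d`.
  refine isCoprime_of_combination (c := area c d * area a b)
    (S := -(C (d.1 * b.2 - d.2 * b.1) + X * C (c.1 * b.2 - c.2 * b.1)))
    (T := C (c.1 * b.2 - c.2 * b.1) + X * C (d.1 * b.2 - d.2 * b.1)) (mul_ne_zero hcd hab) ?_
    (by rwa [eval_one_area_pencil]) (by rwa [eval_neg_one_area_pencil])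
  simp only [area, pencil, map_sub, map_mul]
  ring

theorem isCoprime_area_pencil_reverse {a b c d : K × K} (h : area a c ≠ area b d)
    (h1 : area (a + b) (c + d) ≠ 0) (h2 : area (a - b) (c - d) ≠ 0) :
    IsCoprime (area (pencil a b) (pencil c d)) (area (pencil b a) (pencil d c)) := by
  -- Reversing both pencils swaps the constant and the quadratic coefficient and fixes the linear
  -- one, so the difference is a multiple of `1 - X ^ 2`.
  refine isCoprime_of_combination (c := area a c - area b d) (S := 1) (T := -1)
    (sub_ne_zero.2 h) ?_ (by rwa [eval_one_area_pencil]) (by rwa [eval_neg_one_area_pencil])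
  simp only [area, pencil, map_sub, map_mul]
  ring

end Pencils

/-! ### Strings on a strip in adapted coordinates -/

section Cells

open Polynomial

variable {K : Type*} [Field K]

/-- Labels of a cubic generator, in coordinates adapted to a strip (the first bit runs along the
strip), satisfying the conditions which exclude strings on the strip. -/
structure StripLabels (l : Fin 2 → Fin 2 → Fin 2 → K × K) (κ : K) : Prop where
  sign_ne : κ ≠ 0
  antipode : ∀ c a b, l c.rev a.rev b.rev = κ • l c a b
  area_edge : area (l 0 0 0) (l 1 0 0) ≠ 0
  area_edge' : area (l 0 0 1) (l 1 0 1) ≠ 0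
  area_face : area (l 1 0 0) (l 1 0 1) ≠ 0
  area_face' : area (l 1 0 1) (l 1 1 1) ≠ 0
  area_add : area (l 0 0 0 + l 1 0 0) (l 0 0 1 + l 1 0 1) ≠ 0
  area_sub : area (l 0 0 0 - l 1 0 0) (l 0 0 1 - l 1 0 1) ≠ 0
  area_side : area (l 0 0 0) (l 0 0 1) ≠ area (l 1 0 0) (l 1 0 1)
  area_diag : area (l 0 0 0) (l 1 0 1) ≠ area (l 1 0 0) (l 0 0 1)

/-- The pencils attached to the four edges along the strip. -/
noncomputable def edgePencil (l : Fin 2 → Fin 2 → Fin 2 → K × K) (a b : Fin 2) : K[X] × K[X] :=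
  pencil (l 0 a b) (l 1 a b)

variable {l : Fin 2 → Fin 2 → Fin 2 → K × K} {κ : K}

/-- The antipodal map exchanges the two ends of an edge along the strip, which is why the opposite
edge carries the reversed pencil. -/
theorem StripLabels.edgePencil_one_one (h : StripLabels l κ) :
    edgePencil l 1 1 = pencil (κ • l 1 0 0) (κ • l 0 0 0) := by
  rw [edgePencil, ← h.antipode, ← h.antipode]; rfl

theorem StripLabels.edgePencil_one_zero (h : StripLabels l κ) :
    edgePencil l 1 0 = pencil (κ • l 1 0 1) (κ • l 0 0 1) := by
  rw [edgePencil, ← h.antipode, ← h.antipode]; rfl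

theorem area_add_swap (a b c d : K × K) (h : area (a + b) (c + d) ≠ 0) :
    area (a + b) (d + c) ≠ 0 := by rwa [add_comm d]

theorem area_sub_swap (a b c d : K × K) (h : area (a - b) (c - d) ≠ 0) :
    area (a - b) (d - c) ≠ 0 := by
  contrapose! h
  simp only [area, Prod.fst_sub, Prod.snd_sub] at *
  linear_combination -h

theorem StripLabels.isCoprime_one (h : StripLabels l κ) :
    IsCoprime (area (edgePencil l 0 0) (edgePencil l 1 0))
      (area (edgePencil l 0 0) (edgePencil l 0 1)) := by
  have hu := isUnit_C.2 h.sign_ne.isUnit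
  rw [h.edgePencil_one_zero, area_pencil_smul_right, isCoprime_mul_unit_left_left hu]
  exact (isCoprime_area_pencil_reverse_right h.area_edge h.area_edge' h.area_add h.area_sub).symm

theorem StripLabels.isCoprime_two (h : StripLabels l κ) :
    IsCoprime (area (edgePencil l 0 0) (edgePencil l 1 0))
      (area (edgePencil l 0 1) (edgePencil l 1 1)) := by
  have hu := isUnit_C.2 h.sign_ne.isUnit
  rw [h.edgePencil_one_zero, h.edgePencil_one_one, area_pencil_smul_right, area_pencil_smul_right,
    isCoprime_mul_unit_left_left hu, isCoprime_mul_unit_left_right hu, area_swap (edgePencil l 0 1),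
    IsCoprime.neg_right_iff]
  exact isCoprime_area_pencil_reverse h.area_diag (area_add_swap _ _ _ _ h.area_add)
    (area_sub_swap _ _ _ _ h.area_sub)

theorem StripLabels.isCoprime_three (h : StripLabels l κ) :
    IsCoprime (area (edgePencil l 1 0) (edgePencil l 1 1))
      (area (edgePencil l 0 0) (edgePencil l 0 1)) := by
  have hu := isUnit_C.2 h.sign_ne.isUnit
  rw [h.edgePencil_one_zero, h.edgePencil_one_one, area_pencil_smul_right, area_pencil_smul_left,
    isCoprime_mul_unit_left_left hu, isCoprime_mul_unit_left_left hu, area_swap,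
    IsCoprime.neg_left_iff]
  exact (isCoprime_area_pencil_reverse h.area_side h.area_add h.area_sub).symm

theorem StripLabels.isCoprime_four (h : StripLabels l κ) :
    IsCoprime (area (edgePencil l 1 0) (edgePencil l 1 1))
      (area (edgePencil l 0 1) (edgePencil l 1 1)) := by
  have hu := isUnit_C.2 h.sign_ne.isUnit
  rw [h.edgePencil_one_zero, h.edgePencil_one_one, area_pencil_smul_right, area_pencil_smul_left,
    area_pencil_smul_right,
    isCoprime_mul_unit_left_left hu, isCoprime_mul_unit_left_left hu,
    isCoprime_mul_unit_left_right hu, area_swap, IsCoprime.neg_left_iff,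
    area_swap (edgePencil l 0 1), IsCoprime.neg_right_iff]
  refine isCoprime_area_pencil_reverse_right (a := l 1 0 0) (b := l 0 0 0) (c := l 1 0 1)
    (d := l 0 0 1) ?_ ?_ ?_ ?_
  · rw [area_swap, neg_ne_zero]; exact h.area_edge
  · rw [area_swap, neg_ne_zero]; exact h.area_edge'
  · rw [add_comm, add_comm (l 1 0 1)]; exact h.area_add
  · have := h.area_sub
    contrapose! this
    simp only [area, Prod.fst_sub, Prod.snd_sub] at *
    linear_combination this

theorem exists_area_eq {u v : K × K} (h : area u v ≠ 0) (a b : K) :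
    ∃ w : K × K, area u w = a ∧ area v w = b := by
  refine ⟨((v.1 * a - u.1 * b) / area u v, (v.2 * a - u.2 * b) / area u v), ?_, ?_⟩ <;>
  · have h' := h
    simp only [area] at h' ⊢
    rw [mul_div_assoc', mul_div_assoc', ← sub_div, div_eq_iff h']
    ring

theorem pairing_eq_area (u w : K × K) : pairing u w = area u w := rfl

/-- Prescribing the sums over all squares meeting the bent segment, apart from the two beyond its
end, is possible. -/
theorem exists_squareSum_eq {c : Fin 2 → Fin 2 → K × K} (h1 : area (c 0 0) (c 0 1) ≠ 0)
    (h2 : area (c 0 1) (c 1 1) ≠ 0) (m n : ℕ) (G : ℤ → ℤ → K) :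
    ∃ v : ℤ → ℤ → K × K, (∀ i j, ¬ InBend m n i j → v i j = 0) ∧
      (∀ i : ℤ, 1 ≤ i → i ≤ m → squareSum c v i 0 = G i 0 ∧ squareSum c v i (-1) = G i (-1)) ∧
      (∀ j : ℤ, 0 ≤ j → j ≤ n → squareSum c v (-1) (j - 1) = G (-1) (j - 1) ∧
        squareSum c v 0 (j - 1) = G 0 (j - 1)) := by
  -- The sites are filled in the order of `m - i + j`, which increases from the tip of the first
  -- arm, through the corner, to the tip of the second. Each new site has to meet two equations,
  -- solvable because the two labels involved have nonzero area.
  suffices H : ∀ N : ℕ, ∃ v : ℤ → ℤ → K × K, (∀ i j, ¬ InBend m n i j → v i j = 0) ∧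
      (∀ i : ℤ, 1 ≤ i → i ≤ m → m - i < N →
        squareSum c v i 0 = G i 0 ∧ squareSum c v i (-1) = G i (-1)) ∧
      (∀ j : ℤ, 0 ≤ j → j ≤ n → m + j < N → squareSum c v (-1) (j - 1) = G (-1) (j - 1) ∧
        squareSum c v 0 (j - 1) = G 0 (j - 1)) by
    obtain ⟨v, hv, he, hf⟩ := H (m + n + 1)
    exact ⟨v, hv, fun i hi hi' => he i hi hi' (by omega), fun j hj hj' => hf j hj hj' (by omega)⟩
  intro N
  induction N with
  | zero => exact ⟨0, fun _ _ _ => rfl, fun i _ _ _ => by omega, fun j _ _ _ => by omega⟩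
  | succ N ih =>
    obtain ⟨v, hv, he, hf⟩ := ih
    choose A hA hA' using fun i : ℤ => exists_area_eq h1
      (G i 0 - area (c 1 0) (v (i + 1) 0)) (G i (-1) - area (c 1 1) (v (i + 1) 0))
    choose B hB hB' using fun j : ℤ => exists_area_eq h2
      (G 0 (j - 1) - area (c 0 0) (v 0 (j - 1)) - area (c 1 0) (v 1 (j - 1)) -
        area (c 1 1) (v 1 j)) (G (-1) (j - 1) - area (c 1 0) (v 0 (j - 1)))
    classical
    let v' : ℤ → ℤ → K × K := fun i j =>
      if InBend m n i j ∧ m - i + j = N then (if 1 ≤ i then A i else B j) else v i j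
    have hold : ∀ i j, (InBend m n i j → m - i + j ≠ N) → v' i j = v i j :=
      fun i j hij => if_neg fun h => hij h.1 h.2
    have hAv : ∀ i j : ℤ, 1 ≤ i → i ≤ m → j = 0 → m - i = N → v' i j = A i := fun i j h1 h2 h3 h4 =>
      (if_pos ⟨Or.inl ⟨h3, by omega, h2⟩, by omega⟩).trans (if_pos h1)
    have hBv : ∀ i j : ℤ, i = 0 → 0 ≤ j → j ≤ n → m + j = N → v' i j = B j := fun i j h1 h2 h3 h4 =>
      (if_pos ⟨Or.inr ⟨h1, h2, h3⟩, by omega⟩).trans (if_neg (by omega))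
    refine ⟨v', ?_, ?_, ?_⟩
    · intro i j hij
      rw [hold i j fun h => absurd h hij, hv i j hij]
    · intro i hi him hN
      rcases (show m - i < N ∨ m - i = N by omega) with h | h
      · have := he i hi him h
        simp only [squareSum, neg_add_cancel, zero_add] at this ⊢
        rwa [hold i 0, hold (i + 1) 0, hold i 1, hold (i + 1) 1, hold i (-1),
          hold (i + 1) (-1)] <;> unfold InBend <;> omega
      · have h0 : v i (-1) = 0 := hv _ _ (by unfold InBend; omega)
        have h0' : v (i + 1) (-1) = 0 := hv _ _ (by unfold InBend; omega)
        have h3 : v i 1 = 0 := hv _ _ (by unfold InBend; omega)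
        have h4 : v (i + 1) 1 = 0 := hv _ _ (by unfold InBend; omega)
        simp only [squareSum, neg_add_cancel, zero_add]
        rw [hAv i 0 hi him rfl h, hold (i + 1) 0 (by omega), hold i 1 (by unfold InBend; omega),
          hold (i + 1) 1 (by unfold InBend; omega), hold i (-1) (by unfold InBend; omega),
          hold (i + 1) (-1) (by unfold InBend; omega), h0, h0', h3, h4]
        simp only [pairing_eq_area, area_zero, hA, hA']
        constructor <;> ring
    · intro j hj hjn hN
      rcases (show m + j < N ∨ m + j = N by omega) with h | h
      · have := hf j hj hjn h
        simp only [squareSum, neg_add_cancel, zero_add, sub_add_cancel] at this ⊢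
        rwa [hold (-1) (j - 1), hold 0 (j - 1), hold (-1) j, hold 0 j, hold 1 (j - 1),
          hold 1 j] <;> unfold InBend <;> omega
      · have hneg : ∀ j, v (-1) j = 0 := fun j => hv _ _ (by unfold InBend; omega)
        simp only [squareSum, neg_add_cancel, zero_add, sub_add_cancel]
        rw [hBv 0 j rfl hj hjn h, hold (-1) _ (by unfold InBend; omega), hold 0 (j - 1) (by omega),
          hold (-1) _ (by unfold InBend; omega), hold 1 (j - 1) (by unfold InBend; omega),
          hold 1 j (by unfold InBend; omega), hneg, hneg]
        simp only [pairing_eq_area, area_zero, hB, hB']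
        constructor <;> ring

/-- The sequences of coordinates of a sequence of vectors. -/
def toSeqs {F : Type*} (v : ℕ → F × F) : ShiftSeq F × ShiftSeq F :=
  (fun x => (v x).1, fun x => (v x).2)

theorem toSeqs_zero : toSeqs (fun _ => (0 : K × K)) = 0 := rfl

theorem toSeqs_fst_apply {F : Type*} (v : ℕ → F × F) (x : ℕ) : (toSeqs v).1 x = (v x).1 := rfl

theorem toSeqs_snd_apply {F : Type*} (v : ℕ → F × F) (x : ℕ) : (toSeqs v).2 x = (v x).2 := rfl

theorem pairing_pencil_apply (a b : K × K) (v : ℕ → K × K) (x : ℕ) :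
    pairing (pencil a b) (toSeqs v) x = area a (v x) + area b (v (x + 1)) := by
  simp only [pairing, pencil, add_smul, mul_smul, ShiftSeq.sub_apply, ShiftSeq.add_apply,
    ShiftSeq.X_smul_apply, ShiftSeq.C_smul_apply, toSeqs_fst_apply, toSeqs_snd_apply, area]
  ring

theorem squareSum_edgePencil_apply (l : Fin 2 → Fin 2 → Fin 2 → K × K) (W : ℕ → ℤ → ℤ → K × K)
    (i j : ℤ) (x : ℕ) :
    squareSum (edgePencil l) (fun i j => toSeqs fun x => W x i j) i j x =
      squareSum (l 0) (W x) i j + squareSum (l 1) (W (x + 1)) i j := by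
  simp only [squareSum, edgePencil, ShiftSeq.add_apply, pairing_pencil_apply, pairing_eq_area]
  ring

theorem StripLabels.eq_zero_of_long (h : StripLabels l κ) (m n len : ℕ)
    (hlen : 2 * (m + n + 1) < len) (V : ℕ → ℤ → ℤ → K × K)
    (hV : ∀ x i j, ¬ InBend m n i j → V x i j = 0)
    (hE : ∀ x, x + 1 < len → ∀ i j, squareSum (l 0) (V x) i j + squareSum (l 1) (V (x + 1)) i j = 0)
    (x : ℕ) (hx : x < len) (i j : ℤ) : V x i j = 0 := by
  choose f hf0 hf1 hf2 using fun v : ℤ → ℤ → K × K => exists_squareSum_eq h.area_face h.area_face'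
    m n (fun i j => -squareSum (l 0) v i j)
  -- The given layers below `len`, continued by solving for each next layer in terms of the last
  -- one.
  let W : ℕ → ℤ → ℤ → K × K := fun x =>
    Nat.rec (V 0) (fun x w => if x + 1 < len then V (x + 1) else f w) x
  have hWV : ∀ x < len, W x = V x := by
    intro x hx
    cases x with
    | zero => rfl
    | succ x => exact if_pos hx
  have hWf : ∀ x, ¬ x + 1 < len → W (x + 1) = f (W x) := fun x hx => if_neg hx
  have hW : ∀ x i j, ¬ InBend m n i j → W x i j = 0 := by
    intro x i j hij
    rcases lt_or_ge x len with hx | hx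
    · rw [hWV x hx, hV x i j hij]
    · cases x with
      | zero => omega
      | succ x => rw [hWf x (by omega), hf0 _ i j hij]
  have hEW : ∀ x, x + 1 < len → ∀ i j,
      squareSum (l 0) (W x) i j + squareSum (l 1) (W (x + 1)) i j = 0 := by
    intro x hx i j
    rw [hWV x (by omega), hWV _ hx, hE x hx]
  set U : ℤ → ℤ → ShiftSeq K × ShiftSeq K := fun i j => toSeqs fun x => W x i j with hU
  have hU0 : ∀ i j, ¬ InBend m n i j → U i j = 0 := by
    intro i j hij
    simp only [hU, hW _ i j hij, toSeqs_zero]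
  have hUE : BendEquations (edgePencil l) U m n := by
    refine ⟨fun i hi him => ?_, fun j hj hjn => ?_⟩ <;> constructor <;> ext x <;>
      rw [hU, squareSum_edgePencil_apply, ShiftSeq.zero_apply] <;>
      by_cases hx : x + 1 < len
    · exact hEW x hx _ _
    · rw [hWf x hx, (hf1 _ i hi him).1, add_neg_cancel]
    · exact hEW x hx _ _
    · rw [hWf x hx, (hf1 _ i hi him).2, add_neg_cancel]
    · exact hEW x hx _ _
    · rw [hWf x hx, (hf2 _ j hj hjn).1, add_neg_cancel]
    · exact hEW x hx _ _
    · rw [hWf x hx, (hf2 _ j hj hjn).2, add_neg_cancel]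
  have hend : ∀ i j, squareSum (edgePencil l) U i j = 0 := by
    intro i j
    -- Both factors are nonzero polynomials since they do not vanish at `1`.
    have hQ : area (edgePencil l 0 0) (edgePencil l 0 1) ^ m *
        area (edgePencil l 0 1) (edgePencil l 1 1) ^ (n + 1) ≠ 0 := by
      refine mul_ne_zero (pow_ne_zero _ fun h0 => ?_) (pow_ne_zero _ fun h0 => ?_)
      · have := congrArg (eval 1) h0
        rw [edgePencil, edgePencil, eval_one_area_pencil, eval_zero] at this
        exact h.area_add this
      · have := congrArg (eval 1) h0
        rw [h.edgePencil_one_one, area_pencil_smul_right, eval_mul, eval_C, edgePencil,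
          eval_one_area_pencil, eval_zero, area_swap, add_comm (l 1 0 0), mul_neg, neg_eq_zero] at this
        exact mul_ne_zero h.sign_ne h.area_add this
    refine ShiftSeq.eq_zero_of_smul_eq_zero hQ ?_ fun x hx => ?_
    · rw [smul_squareSum]
      simp only [bend_smul_eq_zero hU0 hUE, squareSum, pairing_zero, add_zero]
    -- The degree is at most `2 (m + n + 1) < len`, so the required initial terms involve only
    -- original layers, on which every equation holds. This is the origin of the bound `2w`.
    · have hdeg : (area (edgePencil l 0 0) (edgePencil l 0 1) ^ m *
          area (edgePencil l 0 1) (edgePencil l 1 1) ^ (n + 1)).natDegree ≤ m * 2 + (n + 1) * 2 :=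
        natDegree_mul_le_of_le (natDegree_pow_le_of_le _ (natDegree_area_pencil_le _ _ _ _))
          (natDegree_pow_le_of_le _ (natDegree_area_pencil_le _ _ _ _))
      rw [hU, squareSum_edgePencil_apply]
      exact hEW x (by omega) i j
  have := bend_eq_zero hU0 hUE (hend _ _) (hend _ _) h.isCoprime_one h.isCoprime_two
    h.isCoprime_three h.isCoprime_four i j
  rw [← hWV x hx]
  exact Prod.ext (congrArg (fun u : ShiftSeq K × ShiftSeq K => u.1 x) this)
    (congrArg (fun u : ShiftSeq K × ShiftSeq K => u.2 x) this)

end Cells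

/-! ### From the hypotheses on the four labels to conditions on all corners of the cube -/

section Labels

/-- The corner of a cube next to `b` along the axis `d`. -/
def flip (d : Fin 3) (b : Fin 3 → Fin 2) : Fin 3 → Fin 2 := Function.update b d (b d).rev

/-- The corner of a cube antipodal to `b`. -/
def antipode (b : Fin 3 → Fin 2) : Fin 3 → Fin 2 := fun i => (b i).rev

/-- Conditions on the labels of a cubic generator which exclude string logical operators. -/
structure CubeLabels {p : ℕ} [Fact p.Prime] (L : (Fin 3 → Fin 2) → Pair p) (κ : ZMod p) :
    Prop where
  sign_sq : κ * κ = 1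
  label_antipode : ∀ b, L (antipode b) = κ • L b
  area_ne : ∀ b b', b' ≠ b → b' ≠ antipode b → area (L b) (L b') ≠ 0
  edges : ∀ b d f, d ≠ f → area (L b + L (flip d b)) (L (flip f b) + L (flip f (flip d b))) *
    area (L b - L (flip d b)) (L (flip f b) - L (flip f (flip d b))) ≠ 0
  side : ∀ b d f, d ≠ f →
    area (L b) (L (flip f b)) ≠ area (L (flip d b)) (L (flip f (flip d b)))
  diag : ∀ b d f, d ≠ f →
    area (L b) (L (flip f (flip d b))) ≠ area (L (flip d b)) (L (flip f b))

/-- The labels of the generators, as a function on the corners of the cube. -/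
def labels {p : ℕ} (κ : Family) (α β γ δ : Pair p) (b : Fin 3 → Fin 2) : Pair p :=
  cornerLabel κ α β γ δ (b 0) (b 1) (b 2)

/-- The position of the label of a corner in the list `α, β, γ, δ`. -/
def cornerIndex : Fin 2 → Fin 2 → Fin 2 → Fin 4
  | 1, 0, 1 => 0
  | 1, 1, 1 => 1
  | 1, 0, 0 => 2
  | 1, 1, 0 => 3
  | 0, 1, 0 => 0
  | 0, 0, 0 => 1
  | 0, 1, 1 => 2
  | 0, 0, 1 => 3

theorem cornerIndex_injective : ∀ b b' : Fin 3 → Fin 2,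
    cornerIndex (b 0) (b 1) (b 2) = cornerIndex (b' 0) (b' 1) (b' 2) →
      b' = b ∨ b' = antipode b := by
  decide

/-- A face contains no two antipodal corners, so all four labels occur on it. -/
theorem cornerIndex_flip : ∀ (b : Fin 3 → Fin 2) (d f : Fin 3), d ≠ f →
    ([b, flip f b, flip d b, flip f (flip d b)].map
      fun b => cornerIndex (b 0) (b 1) (b 2)).Nodup ∧
    ([b, flip f (flip d b), flip d b, flip f b].map
      fun b => cornerIndex (b 0) (b 1) (b 2)).Nodup := by
  decide

variable {p : ℕ} [Fact p.Prime]

theorem Family.sign_mul_self (κ : Family) : κ.sign p * κ.sign p = 1 := by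
  cases κ <;> simp [Family.sign]

theorem labels_eq_smul (κ : Family) (α β γ δ : Pair p) (b : Fin 3 → Fin 2) :
    ∃ c : ZMod p, c * c = 1 ∧
      labels κ α β γ δ b = c • ![α, β, γ, δ] (cornerIndex (b 0) (b 1) (b 2)) := by
  refine ⟨if b 0 = 1 then 1 else κ.sign p, ?_, ?_⟩
  · split_ifs
    · exact mul_one 1
    · exact κ.sign_mul_self
  · unfold labels
    generalize b 0 = x
    generalize b 1 = y
    generalize b 2 = z
    fin_cases x <;> fin_cases y <;> fin_cases z <;> simp [cornerLabel, cornerIndex]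

theorem area_smul_smul (a b : ZMod p) (u v : Pair p) :
    area (a • u) (b • v) = a * b * area u v := by
  simp only [area, Prod.smul_fst, Prod.smul_snd, smul_eq_mul]; ring

/-- For the transition matrix `T`, one has `(T - T⁻¹) T = (T - 1) (T + 1)`, and `rowMat b d` times
`T ∓ 1` is `rowMat (a ∓ b) (c ∓ d)`. Taking determinants links the condition on minimal strings to
the values at `±1` of the area of two pencils. -/
theorem area_add_mul_area_sub_ne_zero {a b c d : Pair p} (hbd : area b d ≠ 0) (hac : area a c ≠ 0)
    (h : (transition b d a c - (transition b d a c)⁻¹).det ≠ 0) :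
    area (a + b) (c + d) * area (a - b) (c - d) ≠ 0 := by
  have hdet : ∀ u v : Pair p, (rowMat u v).det = -area u v := by
    intro u v
    simp only [rowMat, Matrix.det_fin_two_of, area]; ring
  have hN : (rowMat b d).det ≠ 0 := by rw [hdet]; exact neg_ne_zero.2 hbd
  have hM : (rowMat a c).det ≠ 0 := by rw [hdet]; exact neg_ne_zero.2 hac
  have hNT : rowMat b d * transition b d a c = rowMat a c := by
    rw [transition, Matrix.mul_nonsing_inv_cancel_left _ _ hN.isUnit]
  have hT : (transition b d a c).det ≠ 0 := by
    intro h0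
    rw [← hNT, Matrix.det_mul, h0, mul_zero] at hM
    exact hM rfl
  have e1 : (transition b d a c - (transition b d a c)⁻¹) * transition b d a c =
      (transition b d a c - 1) * (transition b d a c + 1) := by
    rw [sub_mul, Matrix.nonsing_inv_mul _ hT.isUnit]
    noncomm_ring
  have e2 : rowMat b d * (transition b d a c - 1) = rowMat (a - b) (c - d) := by
    rw [mul_sub, hNT, mul_one]
    ext i j
    fin_cases i <;> fin_cases j <;> simp [rowMat] <;> ring
  have e3 : rowMat b d * (transition b d a c + 1) = rowMat (a + b) (c + d) := by
    rw [mul_add, hNT, mul_one]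
    ext i j
    fin_cases i <;> fin_cases j <;> simp [rowMat] <;> ring
  have e4 := congrArg Matrix.det e1
  have e5 := congrArg Matrix.det e2
  have e6 := congrArg Matrix.det e3
  rw [Matrix.det_mul, Matrix.det_mul] at e4
  rw [Matrix.det_mul, hdet (a - b)] at e5
  rw [Matrix.det_mul, hdet (a + b)] at e6
  have : area (a + b) (c + d) * area (a - b) (c - d) = (rowMat b d).det * (rowMat b d).det *
      ((transition b d a c - (transition b d a c)⁻¹).det * (transition b d a c).det) := by
    rw [e4]
    linear_combination area (a - b) (c - d) * e6 -
      ((rowMat b d).det * (transition b d a c + 1).det) * e5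
  rw [this]
  exact mul_ne_zero (mul_ne_zero hN hN) (mul_ne_zero h hT)

-- Parallel edges join the same two pairs of labels, so each axis needs just one of the three
-- transition conditions. The antisymmetric sign turns sums into differences and conversely, up to
-- sign, which is why only their product is considered.
set_option maxHeartbeats 1000000 in
theorem edges_labels (κ : Family) {α β γ δ : Pair p}
    (hx : area (α + δ) (β + γ) * area (α - δ) (β - γ) ≠ 0)
    (hy : area (δ + γ) (α + β) * area (δ - γ) (α - β) ≠ 0)
    (hz : area (α + γ) (δ + β) * area (α - γ) (δ - β) ≠ 0)
    (b : Fin 3 → Fin 2) (d f : Fin 3) (hdf : d ≠ f) :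
    area (labels κ α β γ δ b + labels κ α β γ δ (flip d b))
        (labels κ α β γ δ (flip f b) + labels κ α β γ δ (flip f (flip d b))) *
      area (labels κ α β γ δ b - labels κ α β γ δ (flip d b))
        (labels κ α β γ δ (flip f b) - labels κ α β γ δ (flip f (flip d b))) ≠ 0 := by
  simp only [area, Prod.fst_add, Prod.snd_add, Prod.fst_sub, Prod.snd_sub] at hx hy hz ⊢
  obtain ⟨x, y, z, rfl⟩ : ∃ x y z, b = ![x, y, z] :=
    ⟨b 0, b 1, b 2, by funext i; fin_cases i <;> rfl⟩
  intro h0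
  have hκ := κ.sign_mul_self (p := p)
  rcases mul_self_eq_one_iff.1 hκ with hs | hs <;> fin_cases d
  on_goal 1 => apply hx
  on_goal 2 => apply hy
  on_goal 3 => apply hz
  on_goal 4 => apply hx
  on_goal 5 => apply hy
  on_goal 6 => apply hz
  all_goals
    fin_cases f <;> first | exact absurd rfl hdf | skip
  all_goals
    fin_cases x <;> fin_cases y <;> fin_cases z <;>
    simp [labels, flip, cornerLabel, hs, -mul_eq_zero] at h0 <;>
    first
      | linear_combination h0
      | linear_combination -h0

theorem cubeLabels_labels (κ : Family) {α β γ δ : Pair p} (hdef : Deformable α β γ δ)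
    (hmin : NoMinimalString α β γ δ) (hsq : SquaresDiffer α β γ δ) :
    CubeLabels (labels κ α β γ δ) (κ.sign p) := by
  have squares : ∀ b₁ b₂ b₃ b₄ : Fin 3 → Fin 2,
      ([b₁, b₂, b₃, b₄].map fun b => cornerIndex (b 0) (b 1) (b 2)).Nodup →
      area (labels κ α β γ δ b₁) (labels κ α β γ δ b₂) ≠
        area (labels κ α β γ δ b₃) (labels κ α β γ δ b₄) := by
    intro b₁ b₂ b₃ b₄ hb heq
    let f : Fin 4 → Fin 4 := fun i =>
      cornerIndex (![b₁, b₂, b₃, b₄] i 0) (![b₁, b₂, b₃, b₄] i 1) (![b₁, b₂, b₃, b₄] i 2)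
    have hf : Function.Injective f := by
      have : f = ([b₁, b₂, b₃, b₄].map fun b => cornerIndex (b 0) (b 1) (b 2)).get := by
        funext i; fin_cases i <;> rfl
      rw [this]
      exact List.nodup_iff_injective_get.1 hb
    -- The labels at corners are known up to factors of square one; squaring the areas removes these
    -- factors.
    refine hsq (Equiv.ofBijective f (Finite.injective_iff_bijective.1 hf)) ?_
    obtain ⟨c₁, h₁, e₁⟩ := labels_eq_smul κ α β γ δ b₁
    obtain ⟨c₂, h₂, e₂⟩ := labels_eq_smul κ α β γ δ b₂
    obtain ⟨c₃, h₃, e₃⟩ := labels_eq_smul κ α β γ δ b₃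
    obtain ⟨c₄, h₄, e₄⟩ := labels_eq_smul κ α β γ δ b₄
    rw [e₁, e₂, e₃, e₄, area_smul_smul, area_smul_smul] at heq
    change area (![α, β, γ, δ] (cornerIndex (b₁ 0) (b₁ 1) (b₁ 2)))
        (![α, β, γ, δ] (cornerIndex (b₂ 0) (b₂ 1) (b₂ 2))) ^ 2 =
      area (![α, β, γ, δ] (cornerIndex (b₃ 0) (b₃ 1) (b₃ 2)))
        (![α, β, γ, δ] (cornerIndex (b₄ 0) (b₄ 1) (b₄ 2))) ^ 2
    have hsquare := congrArg (· ^ 2) heq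
    simp only [mul_pow] at hsquare
    rwa [sq c₁, sq c₂, sq c₃, sq c₄, h₁, h₂, h₃, h₄, one_mul, one_mul, one_mul] at hsquare
  refine ⟨κ.sign_mul_self, ?_, ?_, ?_, ?_, ?_⟩
  · intro b
    simp only [labels, antipode]
    generalize b 0 = x
    generalize b 1 = y
    generalize b 2 = z
    fin_cases x <;> fin_cases y <;> fin_cases z <;>
      simp [cornerLabel, smul_smul, κ.sign_mul_self]
  · intro b b' hb hb'
    obtain ⟨c, hc, e⟩ := labels_eq_smul κ α β γ δ b
    obtain ⟨c', hc', e'⟩ := labels_eq_smul κ α β γ δ b'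
    rw [e, e', area_smul_smul]
    refine mul_ne_zero (mul_ne_zero (left_ne_zero_of_mul_eq_one hc)
      (left_ne_zero_of_mul_eq_one hc')) (hdef _ _ fun h => ?_)
    exact (cornerIndex_injective b b' h).elim hb hb'
  · have hx := area_add_mul_area_sub_ne_zero (hdef 3 2 (by decide)) (hdef 0 1 (by decide)) hmin.2.1
    have hy := area_add_mul_area_sub_ne_zero (hdef 2 1 (by decide)) (hdef 3 0 (by decide)) hmin.1
    have hz := area_add_mul_area_sub_ne_zero (hdef 2 1 (by decide)) (hdef 0 3 (by decide)) hmin.2.2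
    exact edges_labels κ hx hy hz
  · exact fun b d f hdf => squares _ _ _ _ (cornerIndex_flip b d f hdf).1
  · exact fun b d f hdf => squares _ _ _ _ (cornerIndex_flip b d f hdf).2

end Labels

/-! ### Generators and their commutation -/

section Generators

variable {p : ℕ}

/-- The site at the corner `b` of the unit cube with lowest corner `c`. -/
def corner (c : Site) (b : Fin 3 → Fin 2) : Site := fun i => c i + ((b i : ℕ) : ℤ)

theorem corner_injective (c : Site) : Function.Injective (corner c) := by
  intro b b' h
  funext i
  have := congrFun h i
  simp only [corner] at this
  exact Fin.ext (by omega)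

theorem le_corner (c : Site) (b : Fin 3 → Fin 2) (i : Fin 3) :
    c i ≤ corner c b i ∧ corner c b i ≤ c i + 1 := by
  have := (b i).isLt
  simp only [corner]
  omega

/-- The operator with labels `L` on the unit cube with lowest corner `c`. -/
noncomputable def cubeGen (L : (Fin 3 → Fin 2) → Pair p) (c : Site) : Pauli p :=
  ∑ b, Finsupp.single (corner c b) (L b)

theorem cubeGen_apply (L : (Fin 3 → Fin 2) → Pair p) (c u : Site) :
    cubeGen L c u = ∑ b, if corner c b = u then L b else 0 := by
  simp only [cubeGen, Finsupp.finsetSum_apply, Finsupp.single_apply]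

theorem cubeGen_corner (L : (Fin 3 → Fin 2) → Pair p) (c : Site) (b : Fin 3 → Fin 2) :
    cubeGen L c (corner c b) = L b := by
  simp [cubeGen_apply, (corner_injective c).eq_iff]

theorem exists_corner_of_cubeGen_ne_zero {L : (Fin 3 → Fin 2) → Pair p} {c u : Site}
    (h : cubeGen L c u ≠ 0) : ∃ b, u = corner c b := by
  by_contra! h'
  exact h (by rw [cubeGen_apply]; exact Finset.sum_eq_zero fun b _ => if_neg (h' b).symm)

theorem commutes_cubeGen_iff (L : (Fin 3 → Fin 2) → Pair p) (c : Site) (O : Pauli p) :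
    Commutes (cubeGen L c) O ↔ ∑ b, area (L b) (O (corner c b)) = 0 := by
  unfold Commutes cubeGen
  rw [← Finsupp.sum_finsetSum_index]
  · refine Eq.congr (Finset.sum_congr rfl fun b _ => ?_) rfl
    rw [Finsupp.sum_single_index]
    · rfl
    · simp [symp]
  · intro s; simp [symp]
  · intro s a b; simp only [symp, Prod.fst_add, Prod.snd_add]; ring

theorem Commutes.add {L : (Fin 3 → Fin 2) → Pair p} {c : Site} {O O' : Pauli p}
    (h : Commutes (cubeGen L c) O) (h' : Commutes (cubeGen L c) O') :
    Commutes (cubeGen L c) (O + O') := by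
  rw [commutes_cubeGen_iff] at *
  rw [← add_zero (0 : ZMod p)]
  nth_rw 1 [← h]
  rw [← h', ← Finset.sum_add_distrib]
  refine Finset.sum_congr rfl fun b _ => ?_
  simp only [area, Finsupp.add_apply, Prod.fst_add, Prod.snd_add]; ring

theorem Commutes.neg {L : (Fin 3 → Fin 2) → Pair p} {c : Site} {O : Pauli p}
    (h : Commutes (cubeGen L c) O) : Commutes (cubeGen L c) (-O) := by
  rw [commutes_cubeGen_iff] at *
  rw [← neg_zero, ← h, ← Finset.sum_neg_distrib]
  refine Finset.sum_congr rfl fun b _ => ?_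
  simp only [area, Finsupp.neg_apply, Prod.fst_neg, Prod.snd_neg]; ring

theorem antipode_antipode (b : Fin 3 → Fin 2) : antipode (antipode b) = b := by
  funext i; simp [antipode]

theorem corner_antipode (c : Site) (b : Fin 3 → Fin 2) (i : Fin 3) :
    corner c (antipode b) i = c i + 1 - ((b i : ℕ) : ℤ) := by
  have := (b i).isLt
  simp only [corner, antipode, Fin.val_rev]
  omega

theorem CubeLabels.commutes [Fact p.Prime] {L : (Fin 3 → Fin 2) → Pair p} {κ : ZMod p}
    (h : CubeLabels L κ) (c c' : Site) : Commutes (cubeGen L c) (cubeGen L c') := by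
  rw [commutes_cubeGen_iff]
  have e : ∑ b, area (L b) (cubeGen L c' (corner c b)) =
      ∑ x : (Fin 3 → Fin 2) × (Fin 3 → Fin 2),
        if corner c' x.2 = corner c x.1 then area (L x.1) (L x.2) else 0 := by
    rw [Fintype.sum_prod_type]
    refine Finset.sum_congr rfl fun b _ => ?_
    rw [cubeGen_apply]
    simp only [area, Prod.fst_sum, Prod.snd_sum, Finset.mul_sum, ← Finset.sum_sub_distrib]
    refine Finset.sum_congr rfl fun b' _ => ?_
    split_ifs <;> simp
  have hiff : ∀ b b', corner c' (antipode b) = corner c (antipode b') ↔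
      corner c' b' = corner c b := by
    intro b b'
    simp only [funext_iff, corner_antipode]
    refine forall_congr' fun i => ?_
    simp only [corner]
    omega
  have harea : ∀ b b', area (L (antipode b')) (L (antipode b)) = -area (L b) (L b') := by
    intro b b'
    rw [h.label_antipode, h.label_antipode, area_smul_smul, h.sign_sq, one_mul, area_swap]
  rw [e]
  -- Inversion through the centre of the overlap of the two cubes exchanges the roles of the two
  -- generators. The sign cancels as `κ * κ = 1`, so paired terms are opposite; at a fixed point the
  -- two labels are proportional and the term is zero, whatever the characteristic.
  refine Finset.sum_involution (fun x _ => (antipode x.2, antipode x.1)) ?_ ?_ ?_ ?_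
  · rintro ⟨b, b'⟩ -
    simp only [hiff, harea]
    split_ifs <;> simp
  · rintro ⟨b, b'⟩ - hne heq
    have hb : b = antipode b' := (congrArg Prod.fst heq).symm
    apply hne
    simp only [hb, h.label_antipode]
    split_ifs
    · simp only [area, Prod.smul_fst, Prod.smul_snd, smul_eq_mul]; ring
    · rfl
  · exact fun _ _ => Finset.mem_univ _
  · rintro ⟨b, b'⟩ -
    simp only [antipode_antipode]

theorem CubeLabels.commutes_of_mem_stabilizer [Fact p.Prime] {L : (Fin 3 → Fin 2) → Pair p}
    {κ : ZMod p} (h : CubeLabels L κ) (c : Site) {D : Pauli p}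
    (hD : D ∈ stabilizer (cubeGen L)) : Commutes (cubeGen L c) D := by
  induction hD using AddSubgroup.closure_induction with
  | mem x hx => obtain ⟨c', rfl⟩ := hx; exact h.commutes c c'
  | zero => rw [commutes_cubeGen_iff]; exact Finset.sum_eq_zero fun b _ => by simp [area]
  | add x y _ _ hx hy => exact hx.add hy
  | neg x _ hx => exact hx.neg

theorem CubeLabels.commutes_congr [Fact p.Prime] {L : (Fin 3 → Fin 2) → Pair p}
    {κ : ZMod p} (h : CubeLabels L κ) {c : Site} {O O' : Pauli p}
    (hO : O' - O ∈ stabilizer (cubeGen L)) (hc : Commutes (cubeGen L c) O) :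
    Commutes (cubeGen L c) O' := by
  rw [← sub_add_cancel O' O]
  exact (h.commutes_of_mem_stabilizer c hO).add hc

end Generators

/-! ### Strips in the lattice -/

section Strips

theorem flip_ne (b : Fin 3 → Fin 2) (d : Fin 3) : flip d b ≠ b := by
  revert b d; decide

theorem flip_ne_antipode (b : Fin 3 → Fin 2) (d : Fin 3) : flip d b ≠ antipode b := by
  revert b d; decide

/-- A bit, reversed if the direction `s` is negative. -/
def orientedBit (s : ℤ) (a : Fin 2) : Fin 2 := if s = 1 then a else a.rev

theorem orientedBit_rev (s : ℤ) (a : Fin 2) : orientedBit s a.rev = (orientedBit s a).rev := by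
  unfold orientedBit; split_ifs <;> rfl

/-- The corner of a cube with coordinate `c` along `d`, `a` along the oriented axis `s e`, and `b`
along the third axis with orientation `t`. -/
def stripCorner (d e : Fin 3) (s t : ℤ) (c a b : Fin 2) : Fin 3 → Fin 2 :=
  fun y => if y = d then c else if y = e then orientedBit s a else orientedBit t b

theorem stripCorner_rev (d e : Fin 3) (s t : ℤ) (c a b : Fin 2) :
    stripCorner d e s t c.rev a.rev b.rev = antipode (stripCorner d e s t c a b) := by
  funext y
  simp only [stripCorner, antipode, orientedBit_rev]
  split_ifs <;> rfl

theorem eq_third {d e f : Fin 3} (hde : d ≠ e) (hdf : d ≠ f) (hef : e ≠ f) (y : Fin 3) :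
    y = d ∨ y = e ∨ y = f := by
  omega

variable {d e f : Fin 3} {s t : ℤ}

theorem flip_stripCorner_fst (c a b : Fin 2) :
    flip d (stripCorner d e s t c a b) = stripCorner d e s t c.rev a b := by
  funext y
  simp only [flip, Function.update_apply, stripCorner]
  split_ifs <;> simp_all

theorem flip_stripCorner_snd (hde : d ≠ e) (c a b : Fin 2) :
    flip e (stripCorner d e s t c a b) = stripCorner d e s t c a.rev b := by
  funext y
  simp only [flip, Function.update_apply, stripCorner, orientedBit_rev]
  split_ifs <;> simp_all

theorem flip_stripCorner_thd (hde : d ≠ e) (hdf : d ≠ f) (hef : e ≠ f) (c a b : Fin 2) :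
    flip f (stripCorner d e s t c a b) = stripCorner d e s t c a b.rev := by
  funext y
  simp only [flip, Function.update_apply, stripCorner, orientedBit_rev]
  rcases eq_third hde hdf hef y with rfl | rfl | rfl <;>
    simp [hde.symm, hdf, hdf.symm, hef, hef.symm]

theorem stripCorner_bijective (hde : d ≠ e) (hdf : d ≠ f) (hef : e ≠ f) :
    Function.Bijective fun x : Fin 2 × Fin 2 × Fin 2 => stripCorner d e s t x.1 x.2.1 x.2.2 := by
  rw [Fintype.bijective_iff_injective_and_card]
  refine ⟨?_, by simp⟩
  rintro ⟨c, a, b⟩ ⟨c', a', b'⟩ h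
  have hinj : ∀ s : ℤ, Function.Injective (orientedBit s) := by
    intro s a a' h
    unfold orientedBit at h
    split_ifs at h
    · exact h
    · exact Fin.rev_injective h
  have h1 := congrFun h d
  have h2 := congrFun h e
  have h3 := congrFun h f
  simp only [stripCorner, if_true, if_neg hde.symm, if_neg hdf.symm, if_neg hef.symm] at h1 h2 h3
  rw [h1, hinj _ h2, hinj _ h3]

theorem CubeLabels.stripLabels {p : ℕ} [Fact p.Prime] {L : (Fin 3 → Fin 2) → Pair p} {κ : ZMod p}
    (h : CubeLabels L κ) (hde : d ≠ e) (hdf : d ≠ f) (hef : e ≠ f) :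
    StripLabels (fun c a b => L (stripCorner d e s t c a b)) κ := by
  have r0 : (0 : Fin 2).rev = 1 := rfl
  have r1 : (1 : Fin 2).rev = 0 := rfl
  have hflip : ∀ b d, area (L b) (L (flip d b)) ≠ 0 := fun b d =>
    h.area_ne _ _ (flip_ne b d) (flip_ne_antipode b d)
  have hedges := h.edges (stripCorner d e s t 0 0 0) d f hdf
  have hside := h.side (stripCorner d e s t 0 0 0) d f hdf
  have hdiag := h.diag (stripCorner d e s t 0 0 0) d f hdf
  simp only [flip_stripCorner_fst, flip_stripCorner_thd hde hdf hef, r0] at hedges hside hdiag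
  refine ⟨left_ne_zero_of_mul_eq_one h.sign_sq, ?_, ?_, ?_, ?_, ?_, left_ne_zero_of_mul hedges,
    right_ne_zero_of_mul hedges, hside, hdiag⟩
  · intro c a b
    rw [stripCorner_rev, h.label_antipode]
  · have := hflip (stripCorner d e s t 0 0 0) d
    rwa [flip_stripCorner_fst] at this
  · have := hflip (stripCorner d e s t 0 0 1) d
    rwa [flip_stripCorner_fst] at this
  · have := hflip (stripCorner d e s t 1 0 0) f
    rwa [flip_stripCorner_thd hde hdf hef] at this
  · have := hflip (stripCorner d e s t 1 0 1) e
    rwa [flip_stripCorner_snd hde] at this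

/-- Coordinates adapted to a strip. -/
def stripSite (q : Site) (d e f : Fin 3) (s t : ℤ) (x i j : ℤ) : Site :=
  q + Pi.single d x + Pi.single e (s * i) + Pi.single f (t * j)

/-- The lowest corner of the cube whose first corner, in the coordinates of a strip, is
`(x, i, j)`. -/
def stripCube (q : Site) (d e f : Fin 3) (s t : ℤ) (x i j : ℤ) : Site :=
  q + Pi.single d x + Pi.single e (s * i - if s = 1 then 0 else 1) +
    Pi.single f (t * j - if t = 1 then 0 else 1)

theorem orientedBit_cast {s : ℤ} (hs : |s| = 1) (a : Fin 2) :
    -(if s = 1 then 0 else 1 : ℤ) + ((orientedBit s a : ℕ) : ℤ) = s * (a : ℕ) := by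
  have hs' : s = 1 ∨ s = -1 := eq_or_eq_neg_of_abs_eq hs
  rcases hs' with rfl | rfl <;> fin_cases a <;> simp [orientedBit]

theorem corner_stripCube (hde : d ≠ e) (hdf : d ≠ f) (hef : e ≠ f) (hs : |s| = 1) (ht : |t| = 1)
    (q : Site) (x i j : ℤ) (c a b : Fin 2) :
    corner (stripCube q d e f s t x i j) (stripCorner d e s t c a b) =
      stripSite q d e f s t (x + (c : ℕ)) (i + (a : ℕ)) (j + (b : ℕ)) := by
  have h1 := orientedBit_cast hs a
  have h2 := orientedBit_cast ht b
  funext y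
  simp only [corner, stripCube, stripCorner, stripSite, Pi.add_apply]
  rcases eq_third hde hdf hef y with rfl | rfl | rfl
  · simp [hde, hdf, add_assoc]
  · simp only [Pi.single_eq_same, Pi.single_eq_of_ne hde.symm, Pi.single_eq_of_ne hef,
      if_neg hde.symm, if_true]
    linear_combination h1
  · simp only [Pi.single_eq_same, Pi.single_eq_of_ne hdf.symm, Pi.single_eq_of_ne hef.symm,
      if_neg hdf.symm, if_neg hef.symm]
    linear_combination h2

theorem stripSite_apply_snd (hde : d ≠ e) (hef : e ≠ f) (q : Site) (x i j : ℤ) :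
    stripSite q d e f s t x i j e = q e + s * i := by
  simp [stripSite, hde.symm, hef]

theorem stripSite_apply_thd (hdf : d ≠ f) (hef : e ≠ f) (q : Site) (x i j : ℤ) :
    stripSite q d e f s t x i j f = q f + t * j := by
  simp [stripSite, hdf.symm, hef.symm]

theorem CubeLabels.strip_length_le {p : ℕ} [Fact p.Prime] {L : (Fin 3 → Fin 2) → Pair p}
    {κ : ZMod p} (h : CubeLabels L κ) (d : Fin 3) (k : ℤ) (w l : ℕ) (S : Set Site) (O : Pauli p)
    (hS : IsStrip d k w l S) (hO : (O.support : Set Site) ⊆ S)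
    (hL : IsLogical (cubeGen L) O (before d k) (beyond d (k + l))) (h0 : O ≠ 0) : l ≤ 2 * w := by
  obtain ⟨q, e, f, s, t, m, n, hde, hdf, hef, hs, ht, hw, hq, rfl⟩ := hS
  by_contra! hlen
  subst hw
  have hs0 : s ≠ 0 := by rintro rfl; simp at hs
  have ht0 : t ≠ 0 := by rintro rfl; simp at ht
  have key := (h.stripLabels (s := s) (t := t) hde hdf hef).eq_zero_of_long m n l hlen
    (fun x i j => O (stripSite q d e f s t x i j)) ?_ ?_
  · obtain ⟨u, hu⟩ := Finsupp.ne_iff.1 h0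
    obtain ⟨x, hx, ⟨i, hi, rfl⟩ | ⟨i, hi, rfl⟩⟩ := hO (Finsupp.mem_support_iff.2 hu)
    · have := key x hx i 0
      simp only [stripSite, mul_zero, Pi.single_zero, add_zero] at this
      exact hu this
    · have := key x hx 0 i
      simp only [stripSite, mul_zero, Pi.single_zero, add_zero] at this
      exact hu this
  · intro x i j hij
    by_contra hne
    apply hij
    obtain ⟨x', -, ⟨i', hi', h'⟩ | ⟨i', hi', h'⟩⟩ := hO (Finsupp.mem_support_iff.2 hne)
    · have e1 := congrFun h' e
      have e2 := congrFun h' f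
      rw [stripSite_apply_snd hde hef] at e1
      rw [stripSite_apply_thd hdf hef] at e2
      simp [hde.symm, hdf.symm, hef.symm, hs0, ht0] at e1 e2
      exact Or.inl ⟨e2, by omega, by omega⟩
    · have e1 := congrFun h' e
      have e2 := congrFun h' f
      rw [stripSite_apply_snd hde hef] at e1
      rw [stripSite_apply_thd hdf hef] at e2
      simp [hde.symm, hdf.symm, hef, hs0, ht0] at e1 e2
      exact Or.inr ⟨e1, by omega, by omega⟩
  -- The cube occupies the layers `k + x` and `k + x + 1`, both inside the strip as `x + 1 < l`, so
  -- it is among the generators assumed to commute.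
  · intro x hx i j
    have hd : stripCube q d e f s t x i j d = k + x := by
      simp [stripCube, hde, hdf, hq]
    have hc : Commutes (cubeGen L (stripCube q d e f s t x i j)) O := by
      refine hL _ ?_ ?_ <;>
      · intro u hu
        by_contra hne
        obtain ⟨b, rfl⟩ := exists_corner_of_cubeGen_ne_zero hne
        have := le_corner (stripCube q d e f s t x i j) b d
        simp only [before, beyond, Set.mem_ofPred_eq] at hu
        omega
    rw [commutes_cubeGen_iff, ← (stripCorner_bijective (s := s) (t := t) hde hdf hef).sum_comp,
      Fintype.sum_prod_type] at hc
    simp only [Fintype.sum_prod_type, Fin.sum_univ_two, corner_stripCube hde hdf hef hs ht] at hc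
    simp only [Fin.val_zero, Fin.val_one, Nat.cast_zero, Nat.cast_one, add_zero] at hc
    simp only [squareSum, pairing_eq_area, Nat.cast_add, Nat.cast_one]
    linear_combination hc

end Strips

/-! ### Erasing an operator by multiplication with generators -/

section Erasing

variable {p : ℕ}

/-- Sites can be erased one after the other, in the order of decreasing height, if each can be
erased without affecting the sites erased before. -/
theorem exists_erase (G : AddSubgroup (Pauli p)) (F : Finset Site) (h : Site → ℤ)
    (Reach : Set Site) (O : Pauli p)
    (step : ∀ s ∈ F, ∀ O', O' - O ∈ G → (∀ u ∈ F, h s < h u → O' u = 0) →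
      (∀ u ∉ Reach, O' u = O u) →
      ∃ D ∈ G, O' s + D s = 0 ∧ ∀ u, D u ≠ 0 → u ∈ Reach ∧ (u = s ∨ u ∉ F ∨ h u < h s)) :
    ∃ O', O' - O ∈ G ∧ (∀ u ∉ Reach, O' u = O u) ∧ ∀ u ∈ F, O' u = 0 := by
  classical
  suffices H : ∀ F' : Finset Site, F' ⊆ F → (∀ u ∈ F', ∀ v ∈ F, h u < h v → v ∈ F') →
      ∃ O', O' - O ∈ G ∧ (∀ u ∉ Reach, O' u = O u) ∧ ∀ u ∈ F', O' u = 0 from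
    H F subset_rfl fun _ _ _ hv _ => hv
  intro F'
  induction F' using Finset.induction_on_min_value h with
  | empty => exact fun _ _ => ⟨O, by rw [sub_self]; exact G.zero_mem, fun _ _ => rfl, by simp⟩
  | insert s F' hs hmin ih =>
    intro hsub hup
    obtain ⟨O', h1, h2, h3⟩ := ih ((Finset.subset_insert _ _).trans hsub) fun u hu v hv huv =>
      (Finset.mem_insert.1 (hup u (Finset.mem_insert_of_mem hu) v hv huv)).resolve_left fun hvs => by
        have := hmin u hu
        rw [hvs] at huv
        omega
    have hsF : s ∈ F := hsub (Finset.mem_insert_self _ _)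
    obtain ⟨D, hD, hDs, hDu⟩ := step s hsF O' h1 (fun u hu hlt => h3 u
      ((Finset.mem_insert.1 (hup s (Finset.mem_insert_self _ _) u hu hlt)).resolve_left
        fun hus => by rw [hus] at hlt; exact lt_irrefl _ hlt)) h2
    refine ⟨O' + D, ?_, fun u hu => ?_, fun u hu => ?_⟩
    · rw [add_sub_right_comm]; exact G.add_mem h1 hD
    · rw [Finsupp.add_apply, h2 u hu, add_eq_left]
      by_contra hne
      exact hu (hDu u hne).1
    · rw [Finsupp.add_apply]
      rcases Finset.mem_insert.1 hu with rfl | hu'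
      · exact hDs
      · rw [h3 u hu', zero_add]
        by_contra hne
        rcases (hDu u hne).2 with rfl | h' | h'
        · exact hs hu'
        · exact h' (hsub (Finset.mem_insert_of_mem hu'))
        · have := hmin u hu'; omega

/-- The lowest corner of the cube which has `u` as its corner `k`. -/
def cubeAt (u : Site) (k : Fin 3 → Fin 2) : Site := fun i => u i - ((k i : ℕ) : ℤ)

theorem corner_cubeAt (u : Site) (k : Fin 3 → Fin 2) : corner (cubeAt u k) k = u := by
  funext i; simp [corner, cubeAt]

theorem cubeGen_cubeAt (L : (Fin 3 → Fin 2) → Pair p) (u : Site) (k : Fin 3 → Fin 2) :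
    cubeGen L (cubeAt u k) u = L k := by
  have := cubeGen_corner L (cubeAt u k) k
  rwa [corner_cubeAt] at this

theorem area_eq_zero_of_commutes {L : (Fin 3 → Fin 2) → Pair p} {u : Site} {k : Fin 3 → Fin 2}
    {O : Pauli p} (hc : Commutes (cubeGen L (cubeAt u k)) O)
    (h0 : ∀ b, b ≠ k → O (corner (cubeAt u k) b) = 0) : area (L k) (O u) = 0 := by
  rw [commutes_cubeGen_iff, Finset.sum_eq_single k] at hc
  · rwa [corner_cubeAt] at hc
  · intro b _ hb; rw [h0 b hb, area_zero]
  · simp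

variable [Fact p.Prime]

theorem exists_eq_smul_add_smul {u v : Pair p} (h : area u v ≠ 0) (w : Pair p) :
    ∃ x y : ZMod p, w = x • u + y • v := by
  refine ⟨area w v / area u v, area u w / area u v, ?_⟩
  ext
  · simp only [Prod.fst_add, Prod.smul_fst, smul_eq_mul]
    rw [div_mul_eq_mul_div, div_mul_eq_mul_div, ← add_div, eq_div_iff h]
    simp only [area]; ring
  · simp only [Prod.snd_add, Prod.smul_snd, smul_eq_mul]
    rw [div_mul_eq_mul_div, div_mul_eq_mul_div, ← add_div, eq_div_iff h]
    simp only [area]; ring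

theorem exists_eq_smul_of_area_eq_zero {u v w : Pair p} (h : area u v ≠ 0) (hw : area u w = 0) :
    ∃ x : ZMod p, w = x • u := by
  obtain ⟨x, y, rfl⟩ := exists_eq_smul_add_smul h w
  have hy : y * area u v = 0 := by
    rw [← hw]
    simp only [area, Prod.fst_add, Prod.snd_add, Prod.smul_fst, Prod.smul_snd, smul_eq_mul]
    ring
  rw [(mul_eq_zero.1 hy).resolve_right h]
  exact ⟨x, by simp⟩

theorem eq_zero_of_area_eq_zero {u v w : Pair p} (h : area u v ≠ 0) (hu : area u w = 0)
    (hv : area v w = 0) : w = 0 := by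
  obtain ⟨x, rfl⟩ := exists_eq_smul_of_area_eq_zero h hu
  have hx : x * area u v = 0 := by
    rw [← neg_eq_zero, ← hv]
    simp only [area, Prod.smul_fst, Prod.smul_snd, smul_eq_mul]; ring
  rw [(mul_eq_zero.1 hx).resolve_right h, zero_smul]

theorem smul_cubeGen_mem (L : (Fin 3 → Fin 2) → Pair p) (c : Site) (x : ZMod p) :
    x • cubeGen L c ∈ stabilizer (cubeGen L) :=
  ZMod.smul_mem (K := stabilizer (cubeGen L))
    (AddSubgroup.subset_closure (Set.mem_range_self c)) x

theorem exists_corner_of_smul_cubeGen_ne_zero {L : (Fin 3 → Fin 2) → Pair p} {c u : Site}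
    {x : ZMod p} (h : (x • cubeGen L c) u ≠ 0) : ∃ b, u = corner c b :=
  exists_corner_of_cubeGen_ne_zero (L := L) fun h0 => h (by rw [Finsupp.smul_apply, h0, smul_zero])

variable {L : (Fin 3 → Fin 2) → Pair p} {κ : ZMod p} {d e f : Fin 3} {s : ℤ}

theorem CubeLabels.area_flip_ne (h : CubeLabels L κ) (b : Fin 3 → Fin 2) (i : Fin 3) :
    area (L b) (L (flip i b)) ≠ 0 :=
  h.area_ne _ _ (flip_ne b i) (flip_ne_antipode b i)

theorem CubeLabels.label_ne_zero (h : CubeLabels L κ) (b : Fin 3 → Fin 2) : L b ≠ 0 := by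
  intro h0
  have := h.area_flip_ne b 0
  rw [h0] at this
  simp [area] at this

theorem exists_corner_coordinates (hde : d ≠ e) (hdf : d ≠ f) (hef : e ≠ f) (hs : |s| = 1)
    (u : Site) (c a b : Fin 2) (k : Fin 3 → Fin 2) :
    ∃ c' a' b' : Fin 2, k = stripCorner d e s 1 c' a' b' ∧
      corner (cubeAt u (stripCorner d e s 1 c a b)) k d = u d + (c' : ℕ) - (c : ℕ) ∧
      s * corner (cubeAt u (stripCorner d e s 1 c a b)) k e = s * u e + (a' : ℕ) - (a : ℕ) ∧
      corner (cubeAt u (stripCorner d e s 1 c a b)) k f = u f + (b' : ℕ) - (b : ℕ) := by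
  obtain ⟨⟨c', a', b'⟩, rfl⟩ := (stripCorner_bijective (s := s) (t := 1) hde hdf hef).2 k
  refine ⟨c', a', b', rfl, ?_, ?_, ?_⟩
  · simp only [corner, cubeAt, stripCorner, if_true]; ring
  · have h1 := orientedBit_cast hs a
    have h2 := orientedBit_cast hs a'
    have h3 : s * s = 1 := by rw [← abs_mul_abs_self, hs, one_mul]
    simp only [corner, cubeAt, stripCorner, if_true, if_neg hde.symm]
    linear_combination s * h2 - s * h1 + ((a' : ℕ) - (a : ℕ) : ℤ) * h3
  · simp only [corner, cubeAt, stripCorner, if_neg hdf.symm, if_neg hef.symm, orientedBit, if_true]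
    ring

theorem site_ext (hde : d ≠ e) (hdf : d ≠ f) (hef : e ≠ f) {u v : Site} (h1 : u d = v d)
    (h2 : u e = v e) (h3 : u f = v f) : u = v := by
  funext y
  rcases eq_third hde hdf hef y with rfl | rfl | rfl <;> assumption

/-- Sites can be erased if the cubes at them which point against `d`, along `s e` and along `f`
commute with the operator, and the other corners of these cubes have been erased before. -/
theorem CubeLabels.exists_sweep (h : CubeLabels L κ) (hde : d ≠ e) (hdf : d ≠ f) (hef : e ≠ f)
    (hs : |s| = 1) (F : Finset Site) (Z Reach : Set Site) (O : Pauli p)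
    (hcomm : ∀ u ∈ F, Commutes (cubeGen L (cubeAt u (stripCorner d e s 1 1 0 0))) O)
    (houter : ∀ u ∈ F, ∀ v : Site, u d - 1 ≤ v d → v d ≤ u d → s * u e ≤ s * v e →
      u f ≤ v f → v ∈ F ∨ v ∈ Z)
    (hinner : ∀ u ∈ F, ∀ v : Site, u d ≤ v d → s * u e - 1 ≤ s * v e → s * v e ≤ s * u e →
      u f - 1 ≤ v f → v f ≤ u f → v ∈ Reach)
    (hZ : ∀ v ∈ Z, O v = 0) (hZR : ∀ v ∈ Z, v ∉ Reach) :
    ∃ O', O' - O ∈ stabilizer (cubeGen L) ∧ (∀ v ∉ Reach, O' v = O v) ∧ ∀ v ∈ F, O' v = 0 := by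
  have hanti : antipode (stripCorner d e s 1 1 0 0) = stripCorner d e s 1 0 1 1 :=
    (stripCorner_rev d e s 1 1 0 0).symm
  -- With the other corners of the cube ahead already erased, commutation makes the value at `u` a
  -- multiple of one label. The cube behind has the antipodal, hence proportional, label at `u`, and
  -- all its other corners are lower.
  refine exists_erase _ F (fun u => -u d + s * u e + u f) Reach O fun u hu O' h1 h2 h3 => ?_
  have harea : area (L (stripCorner d e s 1 1 0 0)) (O' u) = 0 := by
    refine area_eq_zero_of_commutes (h.commutes_congr h1 (hcomm u hu)) fun k hk => ?_
    obtain ⟨c', a', b', rfl, e1, e2, e3⟩ := exists_corner_coordinates hde hdf hef hs u 1 0 0 k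
    have hc := c'.isLt
    simp only [Fin.val_zero, Fin.val_one, Nat.cast_zero, Nat.cast_one] at e1 e2 e3
    rcases houter u hu (corner (cubeAt u (stripCorner d e s 1 1 0 0)) (stripCorner d e s 1 c' a' b'))
      (by omega) (by omega) (by omega) (by omega) with hF | hF
    · refine h2 _ hF ?_
      have : ¬ (c' = 1 ∧ a' = 0 ∧ b' = 0) := by
        rintro ⟨rfl, rfl, rfl⟩; exact hk rfl
      simp only [Fin.ext_iff, Fin.val_zero, Fin.val_one] at this
      omega
    · rw [h3 _ (hZR _ hF), hZ _ hF]
  obtain ⟨x, hx⟩ := exists_eq_smul_of_area_eq_zero (h.area_flip_ne _ d) harea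
  refine ⟨(-(x * κ)) • cubeGen L (cubeAt u (stripCorner d e s 1 0 1 1)), smul_cubeGen_mem _ _ _,
    ?_, fun v hv => ?_⟩
  · rw [Finsupp.smul_apply, cubeGen_cubeAt, ← hanti, h.label_antipode, hx, smul_smul, neg_mul, mul_assoc,
      h.sign_sq, mul_one, neg_smul, add_neg_cancel]
  · obtain ⟨k, rfl⟩ := exists_corner_of_smul_cubeGen_ne_zero hv
    obtain ⟨c', a', b', rfl, e1, e2, e3⟩ := exists_corner_coordinates hde hdf hef hs u 0 1 1 k
    have ha := a'.isLt
    have hb := b'.isLt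
    simp only [Fin.val_zero, Fin.val_one, Nat.cast_zero, Nat.cast_one] at e1 e2 e3
    refine ⟨hinner u hu _ (by omega) (by omega) (by omega) (by omega) (by omega), ?_⟩
    by_cases hk : c' = 0 ∧ a' = 1 ∧ b' = 1
    · obtain ⟨rfl, rfl, rfl⟩ := hk
      exact Or.inl (corner_cubeAt _ _)
    · simp only [Fin.ext_iff, Fin.val_zero, Fin.val_one] at hk
      exact Or.inr (Or.inr (by omega))

theorem exists_bound (O : Pauli p) (M : ℤ) :
    ∃ N, M ≤ N ∧ ∀ u, O u ≠ 0 → ∀ i, -N ≤ u i ∧ u i ≤ N := by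
  refine ⟨max M (∑ u ∈ O.support, ∑ i, |u i|), le_max_left _ _, fun u hu i => ?_⟩
  have h1 : |u i| ≤ ∑ i, |u i| :=
    Finset.single_le_sum (f := fun i => |u i|) (fun i _ => abs_nonneg _) (Finset.mem_univ i)
  have h2 : ∑ i, |u i| ≤ ∑ u ∈ O.support, ∑ i, |u i| :=
    Finset.single_le_sum (f := fun u : Site => ∑ i, |u i|)
      (fun u _ => Finset.sum_nonneg fun i _ => abs_nonneg _) (Finsupp.mem_support_iff.2 hu)
  exact abs_le.1 ((h1.trans h2).trans (le_max_right _ _))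

theorem finite_of_bounded (hde : d ≠ e) (hdf : d ≠ f) (hef : e ≠ f) {S : Set Site} (N : ℤ)
    (h : ∀ u ∈ S, -N ≤ u d ∧ u d ≤ N ∧ -N ≤ u e ∧ u e ≤ N ∧ -N ≤ u f ∧ u f ≤ N) : S.Finite := by
  refine (Set.finite_Icc (fun _ => -N : Site) (fun _ => N)).subset fun u hu => ?_
  obtain ⟨h1, h2, h3, h4, h5, h6⟩ := h u hu
  constructor <;> intro y <;> rcases eq_third hde hdf hef y with rfl | rfl | rfl <;> assumption

/-- In the half-space `u d < B`, an operator confined to `z₀ ≤ u f ≤ z₁` can be erased from a region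
`m ≤ s u e` in which it commutes with all generators. -/
theorem CubeLabels.exists_clear (h : CubeLabels L κ) (hde : d ≠ e) (hdf : d ≠ f) (hef : e ≠ f)
    (hs : |s| = 1) (B m z₀ z₁ : ℤ) (O : Pauli p)
    (hcomm : ∀ c, (∀ b, corner c b d < B ∧ m ≤ s * corner c b e) → Commutes (cubeGen L c) O)
    (hf : ∀ u, u d < B → O u ≠ 0 → z₀ ≤ u f ∧ u f ≤ z₁) :
    ∃ O', O' - O ∈ stabilizer (cubeGen L) ∧
      (∀ u : Site, u d < B → m ≤ s * u e → O' u = 0) ∧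
      ∀ u, O' u ≠ O u → (z₀ ≤ u f ∧ u f ≤ z₁) ∧ m - 1 ≤ s * u e := by
  obtain ⟨N, hN, hbound⟩ := exists_bound O (|B| + |m| + |z₀| + |z₁|)
  have hs' : s = 1 ∨ s = -1 := eq_or_eq_neg_of_abs_eq hs
  have hboundE : ∀ u, O u ≠ 0 → s * u e ≤ N := by
    intro u hu
    have := hbound u hu e
    rcases hs' with rfl | rfl <;> omega
  have hB := le_abs_self B
  have hm := neg_abs_le m
  have hz₀ := neg_abs_le z₀
  have hz₁ := le_abs_self z₁
  have := abs_nonneg B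
  have := abs_nonneg m
  have := abs_nonneg z₀
  have := abs_nonneg z₁
  let S : Set Site := {u | -N ≤ u d ∧ u d < B ∧ m ≤ s * u e ∧ s * u e ≤ N ∧ z₀ < u f ∧ u f ≤ z₁}
  have hS : S.Finite := by
    refine finite_of_bounded hde hdf hef N ?_
    rintro u ⟨h1, h2, h3, h4, h5, h6⟩
    refine ⟨h1, by omega, ?_, ?_, by omega, by omega⟩ <;> rcases hs' with rfl | rfl <;> omega
  -- There is no upper bound on `u d`: the sweep may push the operator past the layer `B`, where
  -- nothing is claimed.
  let Reach : Set Site := {u | -N ≤ u d ∧ m - 1 ≤ s * u e ∧ s * u e ≤ N ∧ z₀ ≤ u f ∧ u f ≤ z₁}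
  have hOR : ∀ u, u d < B → m ≤ s * u e → u ∉ Reach → O u = 0 := by
    intro u h1 h2 h3
    by_contra hne
    have h4 := hf u h1 hne
    have h5 := hbound u hne d
    have h6 := hboundE u hne
    exact h3 ⟨h5.1, by omega, h6, h4.1, h4.2⟩
  have hcube : ∀ (u : Site) (b : Fin 2), u d < B → m ≤ s * u e →
      Commutes (cubeGen L (cubeAt u (stripCorner d e s 1 1 0 b))) O := by
    intro u b h1 h2
    refine hcomm _ fun k => ?_
    obtain ⟨c', a', b', rfl, e1, e2, e3⟩ := exists_corner_coordinates hde hdf hef hs u 1 0 b k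
    have hc := c'.isLt
    simp only [Fin.val_zero, Fin.val_one, Nat.cast_zero, Nat.cast_one] at e1 e2
    omega
  obtain ⟨O', h1, h2, h3⟩ := h.exists_sweep hde hdf hef hs hS.toFinset
    {u | u d < B ∧ m ≤ s * u e ∧ z₀ < u f ∧ u ∉ hS.toFinset} Reach O
    (fun u hu => hcube u 0 ((hS.mem_toFinset.1 hu).2.1) ((hS.mem_toFinset.1 hu).2.2.1))
    (fun u hu v _ _ _ _ => by
      obtain ⟨h1, h2, h3, h4, h5, h6⟩ := hS.mem_toFinset.1 hu
      by_cases hv : v ∈ hS.toFinset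
      · exact Or.inl hv
      · exact Or.inr ⟨by omega, by omega, by omega, hv⟩)
    (fun u hu v _ _ _ _ _ => by
      obtain ⟨h1, h2, h3, h4, h5, h6⟩ := hS.mem_toFinset.1 hu
      exact ⟨by omega, by omega, by omega, by omega, by omega⟩)
    (fun v ⟨h1, h2, h3, h4⟩ => hOR v h1 h2 fun ⟨h5, _, h7, _, h9⟩ =>
      h4 (hS.mem_toFinset.2 ⟨h5, h1, h2, h7, h3, h9⟩))
    (fun v ⟨h1, h2, h3, h4⟩ ⟨h5, _, h7, _, h9⟩ =>
      h4 (hS.mem_toFinset.2 ⟨h5, h1, h2, h7, h3, h9⟩))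
  -- After the sweep, only the sheet `u f = z₀` remains in the region.
  have hsheet : ∀ u, u d < B → m ≤ s * u e → u f ≠ z₀ ∨ u ∉ Reach → O' u = 0 := by
    intro u hd he hu
    by_cases hR : u ∈ Reach
    · have hz := hu.resolve_right (not_not.2 hR)
      obtain ⟨h5, _, h7, h8, h9⟩ := hR
      exact h3 u (hS.mem_toFinset.2 ⟨h5, hd, he, h7, by omega, h9⟩)
    · rw [h2 u hR, hOR u hd he hR]
  -- The sheet is then trivial by itself: cubes on both of its sides meet it in the same square.
  -- Going diagonally inwards from where `u d < -N` or `s * u e > N`, each value is orthogonal to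
  -- two independent labels.
  have hzero : ∀ n : ℕ, ∀ u : Site, u d - s * u e + 2 * N < n → u d < B → m ≤ s * u e →
      O' u = 0 := by
    intro n
    induction n with
    | zero =>
      intro u hn hd he
      exact hsheet u hd he (Or.inr fun ⟨h5, _, h7, _, _⟩ => by omega)
    | succ n ih =>
      intro u hn hd he
      by_cases hz : u f = z₀
      swap
      · exact hsheet u hd he (Or.inl hz)
      have harea : ∀ b : Fin 2, area (L (stripCorner d e s 1 1 0 b)) (O' u) = 0 := by
        intro b
        refine area_eq_zero_of_commutes (h.commutes_congr h1 (hcube u b hd he)) fun k hk => ?_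
        obtain ⟨c', a', b', rfl, e1, e2, e3⟩ := exists_corner_coordinates hde hdf hef hs u 1 0 b k
        have hc := c'.isLt
        simp only [Fin.val_zero, Fin.val_one, Nat.cast_zero, Nat.cast_one] at e1 e2 e3
        by_cases hb : b' = b
        · have : ¬ (c' = 1 ∧ a' = 0) := by
            rintro ⟨rfl, rfl⟩; exact hk (by rw [hb])
          simp only [Fin.ext_iff, Fin.val_zero, Fin.val_one] at this
          exact ih _ (by omega) (by omega) (by omega)
        · rw [Fin.ext_iff] at hb
          exact hsheet _ (by omega) (by omega) (Or.inl (by omega))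
      refine eq_zero_of_area_eq_zero ?_ (harea 0) (harea 1)
      have := h.area_flip_ne (stripCorner d e s 1 1 0 0) f
      rwa [flip_stripCorner_thd hde hdf hef] at this
  refine ⟨O', h1, fun u hd he => hzero (u d - s * u e + 2 * N + 1).toNat u (by omega) hd he,
    fun u hu => ?_⟩
  have hR : u ∈ Reach := by
    by_contra hR
    exact hu (h2 u hR)
  exact ⟨⟨hR.2.2.2.1, hR.2.2.2.2⟩, hR.2.1⟩

/-- In the half-space `u d < B`, an operator confined to `z₀ ≤ u f ≤ z₁` can be confined to
`y₀ ≤ u e ≤ y₁` if it commutes with all generators beyond these bounds. -/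
theorem CubeLabels.exists_confine (h : CubeLabels L κ) (hde : d ≠ e) (hdf : d ≠ f) (hef : e ≠ f)
    (B y₀ y₁ z₀ z₁ : ℤ) (hy : y₀ ≤ y₁) (O : Pauli p)
    (hcomm : ∀ c, (∀ b, corner c b d < B) →
      ((∀ b, corner c b e < y₀) ∨ ∀ b, y₁ < corner c b e) → Commutes (cubeGen L c) O)
    (hf : ∀ u, u d < B → O u ≠ 0 → z₀ ≤ u f ∧ u f ≤ z₁) :
    ∃ O', O' - O ∈ stabilizer (cubeGen L) ∧
      ∀ u, u d < B → O' u ≠ 0 → (y₀ ≤ u e ∧ u e ≤ y₁) ∧ z₀ ≤ u f ∧ u f ≤ z₁ := by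
  obtain ⟨O₁, h1, h2, h3⟩ := h.exists_clear (s := 1) hde hdf hef (by simp) B (y₁ + 1) z₀ z₁ O
    (fun c hc => hcomm c (fun b => (hc b).1) (Or.inr fun b => by have := (hc b).2; omega)) hf
  have hf₁ : ∀ u, u d < B → O₁ u ≠ 0 → z₀ ≤ u f ∧ u f ≤ z₁ := by
    intro u hd hu
    by_cases heq : O₁ u = O u
    · exact hf u hd (by rwa [← heq])
    · exact (h3 u heq).1
  -- The second clearing changes only sites with `u e ≤ y₀ ≤ y₁`, so what the first one achieved
  -- persists.
  obtain ⟨O₂, h4, h5, h6⟩ := h.exists_clear (s := -1) hde hdf hef (by simp) B (1 - y₀) z₀ z₁ O₁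
    (fun c hc => h.commutes_congr h1 (hcomm c (fun b => (hc b).1)
      (Or.inl fun b => by have := (hc b).2; omega))) hf₁
  refine ⟨O₂, ?_, fun u hd hu => ⟨⟨?_, ?_⟩, ?_⟩⟩
  · rw [← sub_add_sub_cancel O₂ O₁ O]; exact add_mem h4 h1
  · by_contra hlt
    exact hu (h5 u hd (by omega))
  · by_contra hlt
    by_cases heq : O₂ u = O₁ u
    · exact hu (by rw [heq, h2 u hd (by omega)])
    · have := (h6 u heq).2; omega
  · by_cases heq : O₂ u = O₁ u
    · exact hf₁ u hd (by rwa [← heq])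
    · exact (h6 u heq).1

end Erasing

/-! ### Opening a gap between distant anchors -/

section Gap

theorem Linked.le_add_one {p : ℕ} {L : (Fin 3 → Fin 2) → Pair p} {u v : Site}
    (h : Linked (cubeGen L) u v) (i : Fin 3) : v i ≤ u i + 1 ∧ u i ≤ v i + 1 := by
  obtain ⟨c, hu, hv⟩ := h
  obtain ⟨b, rfl⟩ := exists_corner_of_cubeGen_ne_zero hu
  obtain ⟨b', rfl⟩ := exists_corner_of_cubeGen_ne_zero hv
  have h1 := le_corner c b i
  have h2 := le_corner c b' i
  omega

/-- Linked sites differ by at most one in each coordinate, so even a single empty layer cannot be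
jumped. -/
theorem not_joinedIn_of_gap {p : ℕ} {L : (Fin 3 → Fin 2) → Pair p} (O : Pauli p)
    (d : Fin 3) (x B : ℤ) (hxB : x < B)
    (hO : ∀ u : Site, x ≤ u d → u d < B → O u = 0) {s t : Site}
    (hst : (s d < x ∧ B ≤ t d) ∨ (B ≤ s d ∧ t d < x)) :
    ¬ JoinedIn (cubeGen L) ((O.support : Set Site) ∪ {s, t}) s t := by
  rintro ⟨-, hpath⟩
  have hgap : ∀ v ∈ (O.support : Set Site) ∪ {s, t}, v d < x ∨ B ≤ v d := by
    rintro v (hv | rfl | rfl)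
    · by_contra! hne
      exact Finsupp.mem_support_iff.1 hv (hO v hne.1 hne.2)
    · omega
    · omega
  rcases hst with ⟨h1, h2⟩ | ⟨h1, h2⟩
  · have hside : ∀ v, Relation.ReflTransGen (fun u v => v ∈ (O.support : Set Site) ∪ {s, t} ∧
        Linked (cubeGen L) u v) s v → v d < x := by
      intro v hv
      induction hv with
      | refl => exact h1
      | tail _ hstep ih =>
        have := hgap _ hstep.1
        have := hstep.2.le_add_one d
        omega
    have := hside t hpath
    omega
  · have hside : ∀ v, Relation.ReflTransGen (fun u v => v ∈ (O.support : Set Site) ∪ {s, t} ∧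
        Linked (cubeGen L) u v) s v → B ≤ v d := by
      intro v hv
      induction hv with
      | refl => exact h1
      | tail _ hstep ih =>
        have := hgap _ hstep.1
        have := hstep.2.le_add_one d
        omega
    have := hside t hpath
    omega

variable {p : ℕ} [Fact p.Prime] {L : (Fin 3 → Fin 2) → Pair p} {κ : ZMod p} {d e f : Fin 3}

/-- Any single layer of a rectangular column can be reduced to two of its sides, without changing
the operator outside of the column. -/
theorem CubeLabels.exists_clear_layer (h : CubeLabels L κ) (hde : d ≠ e) (hdf : d ≠ f)
    (hef : e ≠ f) (x y₀ y₁ z₀ z₁ : ℤ) (O : Pauli p) :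
    ∃ O', O' - O ∈ stabilizer (cubeGen L) ∧
      (∀ u, O' u ≠ O u → (y₀ ≤ u e ∧ u e ≤ y₁) ∧ z₀ ≤ u f ∧ u f ≤ z₁) ∧
      ∀ u : Site, u d = x → y₀ < u e → u e ≤ y₁ → z₀ < u f → u f ≤ z₁ → O' u = 0 := by
  have hs : |(1 : ℤ)| = 1 := abs_one
  have hfin : {u : Site | u d = x ∧ y₀ < u e ∧ u e ≤ y₁ ∧ z₀ < u f ∧ u f ≤ z₁}.Finite := by
    refine finite_of_bounded hde hdf hef (|x| + |y₀| + |y₁| + |z₀| + |z₁|) ?_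
    rintro u ⟨h1, h2, h3, h4, h5⟩
    have := le_abs_self x
    have := neg_abs_le x
    have := neg_abs_le y₀
    have := le_abs_self y₁
    have := neg_abs_le z₀
    have := le_abs_self z₁
    have := abs_nonneg x
    have := abs_nonneg y₀
    have := abs_nonneg y₁
    have := abs_nonneg z₀
    have := abs_nonneg z₁
    omega
  have step : ∀ u ∈ hfin.toFinset, ∀ O' : Pauli p, ∃ D ∈ stabilizer (cubeGen L), O' u + D u = 0 ∧
      ∀ v, D v ≠ 0 → v ∈ {u : Site | y₀ ≤ u e ∧ u e ≤ y₁ ∧ z₀ ≤ u f ∧ u f ≤ z₁} ∧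
        (v = u ∨ v ∉ hfin.toFinset ∨ v e + v f < u e + u f) := by
    intro u hu O'
    obtain ⟨hu1, hu2, hu3, hu4, hu5⟩ := hfin.mem_toFinset.1 hu
    -- The two cubes on either side of the layer, with `u` as their farthest corner along `e` and
    -- `f`, carry independent labels at `u`. Together they cancel any value, so no commutation is
    -- needed.
    have harea := h.area_flip_ne (stripCorner d e 1 1 0 1 1) d
    rw [flip_stripCorner_fst] at harea
    obtain ⟨y, z, hyz⟩ := exists_eq_smul_add_smul harea (-O' u)
    refine ⟨y • cubeGen L (cubeAt u (stripCorner d e 1 1 0 1 1)) +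
      z • cubeGen L (cubeAt u (stripCorner d e 1 1 (Fin.rev 0) 1 1)),
      add_mem (smul_cubeGen_mem _ _ _) (smul_cubeGen_mem _ _ _), ?_, fun v hv => ?_⟩
    · rw [Finsupp.add_apply, Finsupp.smul_apply, Finsupp.smul_apply, cubeGen_cubeAt,
        cubeGen_cubeAt, ← hyz, add_neg_cancel]
    · obtain ⟨c, k, rfl⟩ : ∃ (c : Fin 2) (k : Fin 3 → Fin 2),
          v = corner (cubeAt u (stripCorner d e 1 1 c 1 1)) k := by
        by_contra! hne
        apply hv
        rw [Finsupp.add_apply]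
        have h0 : ∀ (x : ZMod p) (c : Fin 2),
            (x • cubeGen L (cubeAt u (stripCorner d e 1 1 c 1 1))) v = 0 := by
          intro x c
          by_contra h0
          obtain ⟨k, hk⟩ := exists_corner_of_smul_cubeGen_ne_zero h0
          exact hne c k hk
        rw [h0, h0, add_zero]
      obtain ⟨c', a', b', rfl, e1, e2, e3⟩ := exists_corner_coordinates hde hdf hef hs u c 1 1 k
      have ha := a'.isLt
      have hb := b'.isLt
      simp only [Fin.val_one, Nat.cast_one, one_mul] at e2 e3
      refine ⟨⟨by omega, by omega, by omega, by omega⟩, ?_⟩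
      set v := corner (cubeAt u (stripCorner d e 1 1 c 1 1)) (stripCorner d e 1 1 c' a' b')
      by_cases hv : v ∈ hfin.toFinset
      · have hvd := (hfin.mem_toFinset.1 hv).1
        by_cases hlt : v e + v f < u e + u f
        · exact Or.inr (Or.inr hlt)
        · exact Or.inl (site_ext hde hdf hef (by omega) (by omega) (by omega))
      · exact Or.inr (Or.inl hv)
  obtain ⟨O', h1, h2, h3⟩ := exists_erase (stabilizer (cubeGen L)) hfin.toFinset
    (fun u => u e + u f) _ O fun u hu O' _ _ _ => step u hu O'
  refine ⟨O', h1, fun u hu => ?_, fun u h4 h5 h6 h7 h8 =>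
    h3 u (hfin.mem_toFinset.2 ⟨h4, h5, h6, h7, h8⟩)⟩
  by_contra hR
  exact hu (h2 u fun ⟨h4, h5, h6, h7⟩ => hR ⟨⟨h4, h5⟩, h6, h7⟩)

/-- In the layers `x ≤ u d < B`, an operator confined to a rectangular column can be reduced to two
sides of the column, if it commutes with the generators on these layers. -/
theorem CubeLabels.exists_bend (h : CubeLabels L κ) (hde : d ≠ e) (hdf : d ≠ f) (hef : e ≠ f)
    (x B y₀ y₁ z₀ z₁ : ℤ) (O : Pauli p)
    (hcomm : ∀ c, (∀ b, x ≤ corner c b d ∧ corner c b d < B) → Commutes (cubeGen L c) O)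
    (hO : ∀ u, u d < B → O u ≠ 0 → (y₀ ≤ u e ∧ u e ≤ y₁) ∧ z₀ ≤ u f ∧ u f ≤ z₁) :
    ∃ O', O' - O ∈ stabilizer (cubeGen L) ∧ ∀ u, x ≤ u d → u d < B → O' u ≠ 0 →
      ((y₀ ≤ u e ∧ u e ≤ y₁) ∧ z₀ ≤ u f ∧ u f ≤ z₁) ∧ (u e = y₀ ∨ u f = z₀) := by
  have hs : |(1 : ℤ)| = 1 := abs_one
  obtain ⟨O₁, h1, h2, h3⟩ := h.exists_clear_layer hde hdf hef x y₀ y₁ z₀ z₁ O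
  have hO₁ : ∀ u, u d < B → O₁ u ≠ 0 → (y₀ ≤ u e ∧ u e ≤ y₁) ∧ z₀ ≤ u f ∧ u f ≤ z₁ := by
    intro u hd hu
    by_cases heq : O₁ u = O u
    · exact hO u hd (by rwa [← heq])
    · exact h2 u heq
  have hfin : {u : Site | x < u d ∧ u d < B ∧ y₀ < u e ∧ u e ≤ y₁ ∧ z₀ < u f ∧ u f ≤ z₁}.Finite := by
    refine finite_of_bounded hde hdf hef (|x| + |B| + |y₀| + |y₁| + |z₀| + |z₁|) ?_
    rintro u ⟨h1, h2, h3, h4, h5, h6⟩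
    have := neg_abs_le x
    have := le_abs_self B
    have := neg_abs_le y₀
    have := le_abs_self y₁
    have := neg_abs_le z₀
    have := le_abs_self z₁
    have := abs_nonneg x
    have := abs_nonneg B
    have := abs_nonneg y₀
    have := abs_nonneg y₁
    have := abs_nonneg z₀
    have := abs_nonneg z₁
    omega
  -- The cleared layer `x` is the seed: each cube used for testing reaches one layer back, so the
  -- sweep can start at `x + 1`.
  obtain ⟨O₂, h4, h5, h6⟩ := h.exists_sweep hde hdf hef hs hfin.toFinset
    {u | x ≤ u d ∧ u d < B ∧ y₀ < u e ∧ z₀ < u f ∧ u ∉ hfin.toFinset}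
    {u | x < u d ∧ y₀ ≤ u e ∧ u e ≤ y₁ ∧ z₀ ≤ u f ∧ u f ≤ z₁} O₁
    (fun u hu => by
      obtain ⟨g1, g2, -⟩ := hfin.mem_toFinset.1 hu
      refine h.commutes_congr h1 (hcomm _ fun k => ?_)
      obtain ⟨c', a', b', rfl, e1, -, -⟩ := exists_corner_coordinates hde hdf hef hs u 1 0 0 k
      have hc := c'.isLt
      simp only [Fin.val_one, Nat.cast_one] at e1
      omega)
    (fun u hu v _ _ _ _ => by
      obtain ⟨g1, g2, g3, g4, g5, g6⟩ := hfin.mem_toFinset.1 hu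
      by_cases hv : v ∈ hfin.toFinset
      · exact Or.inl hv
      · exact Or.inr ⟨by omega, by omega, by omega, by omega, hv⟩)
    (fun u hu v _ _ _ _ _ => by
      obtain ⟨g1, g2, g3, g4, g5, g6⟩ := hfin.mem_toFinset.1 hu
      exact ⟨by omega, by omega, by omega, by omega, by omega⟩)
    (fun v ⟨g1, g2, g3, g4, g5⟩ => by
      by_contra hne
      obtain ⟨⟨-, g6⟩, -, g7⟩ := hO₁ v g2 hne
      by_cases hx : v d = x
      · exact hne (h3 v hx g3 g6 g4 g7)
      · exact g5 (hfin.mem_toFinset.2 ⟨by omega, g2, g3, g6, g4, g7⟩))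
    (fun v ⟨g1, g2, g3, g4, g5⟩ ⟨g6, _, g7, _, g8⟩ =>
      g5 (hfin.mem_toFinset.2 ⟨g6, g2, g3, g7, g4, g8⟩))
  refine ⟨O₂, ?_, fun u hx hd hu => ?_⟩
  · rw [← sub_add_sub_cancel O₂ O₁ O]; exact add_mem h4 h1
  have hcol : (y₀ ≤ u e ∧ u e ≤ y₁) ∧ z₀ ≤ u f ∧ u f ≤ z₁ := by
    by_cases heq : O₂ u = O₁ u
    · exact hO₁ u hd (by rwa [← heq])
    · by_contra hR
      exact heq (h5 u fun ⟨_, g1, g2, g3, g4⟩ => hR ⟨⟨g1, g2⟩, g3, g4⟩)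
  refine ⟨hcol, ?_⟩
  by_contra! hne
  obtain ⟨⟨g1, g2⟩, g3, g4⟩ := hcol
  by_cases hux : u d = x
  · rw [h5 u fun hR => by have := hR.1; omega,
      h3 u hux (by omega) g2 (by omega) g4] at hu
    exact hu rfl
  · exact hu (h6 u (hfin.mem_toFinset.2 ⟨by omega, hd, by omega, g2, by omega, g4⟩))

/-- An operator on a long strip with one corner, which commutes with the generators on the layers
of the strip, is trivial on these layers. -/
theorem CubeLabels.eq_zero_on_bend (h : CubeLabels L κ) (hde : d ≠ e) (hdf : d ≠ f) (hef : e ≠ f)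
    (x B y z : ℤ) (n : ℕ) (hlen : 2 * (n + n + 1) < B - x) (O : Pauli p)
    (hcomm : ∀ c, (∀ b, x ≤ corner c b d ∧ corner c b d < B) → Commutes (cubeGen L c) O)
    (hO : ∀ u, x ≤ u d → u d < B → O u ≠ 0 →
      ((y ≤ u e ∧ u e ≤ y + n) ∧ z ≤ u f ∧ u f ≤ z + n) ∧ (u e = y ∨ u f = z))
    (u : Site) (hx : x ≤ u d) (hB : u d < B) : O u = 0 := by
  classical
  -- Cutting off all other layers does not affect generators on these layers. Conversely, since no
  -- label is zero, a generator trivial outside them has all its corners inside.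
  let O' : Pauli p := O.filter fun u => x ≤ u d ∧ u d < B
  have hO' : ∀ u : Site, x ≤ u d ∧ u d < B → O' u = O u := fun u hu =>
    Finsupp.filter_apply_pos (fun u : Site => x ≤ u d ∧ u d < B) O hu
  have hl : ((B - x).toNat : ℤ) = B - x := Int.toNat_of_nonneg (by omega)
  suffices hzero : O' = 0 by rw [← hO' u ⟨hx, hB⟩, hzero]; rfl
  by_contra hne
  let q : Site := fun i => if i = d then x else if i = e then y else z
  have hqd : q d = x := by simp [q]
  have hqe : q e = y := by simp [q, hde.symm]
  have hqf : q f = z := by simp [q, hdf.symm, hef.symm]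
  have := h.strip_length_le d x (n + n + 1) (B - x).toNat _ O'
    ⟨q, e, f, 1, 1, n, n, hde, hdf, hef, abs_one, abs_one, rfl, hqd, rfl⟩ ?_ ?_ hne
  · omega
  · intro v hv
    have hv' : O' v ≠ 0 := Finsupp.mem_support_iff.1 hv
    have hvd : x ≤ v d ∧ v d < B := by
      by_contra hvd
      exact hv' (Finsupp.filter_apply_neg (fun u : Site => x ≤ u d ∧ u d < B) O hvd)
    rw [hO' v hvd] at hv'
    obtain ⟨⟨⟨g1, g2⟩, g3, g4⟩, g5⟩ := hO v hvd.1 hvd.2 hv'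
    refine ⟨(v d - x).toNat, by omega, ?_⟩
    rcases g5 with g5 | g5
    · refine Or.inr ⟨(v f - z).toNat, by omega, site_ext hde hdf hef ?_ ?_ ?_⟩
      · simp [hdf, hqd]; omega
      · simp [hde.symm, hef, hqe, g5]
      · simp [hdf.symm, hqf]; omega
    · refine Or.inl ⟨(v e - y).toNat, by omega, site_ext hde hdf hef ?_ ?_ ?_⟩
      · simp [hde, hqd]; omega
      · simp [hde.symm, hqe]; omega
      · simp [hdf.symm, hef.symm, hqf, g5]
  · intro c h1 h2
    have hc : ∀ b, x ≤ corner c b d ∧ corner c b d < B := by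
      intro b
      by_contra hb
      apply h.label_ne_zero b
      rw [← cubeGen_corner L c b]
      rcases lt_or_ge (corner c b d) x with hlt | hge
      · exact h1 _ hlt
      · exact h2 _ (show x + ((B - x).toNat : ℤ) ≤ corner c b d by omega)
    have := hcomm c hc
    rw [commutes_cubeGen_iff] at this ⊢
    rw [← this]
    exact Finset.sum_congr rfl fun b _ => by rw [hO' _ (hc b)]

/-- A logical string segment whose anchors are far apart along an axis is equivalent to one which is
trivial on all layers between the anchors. -/
theorem CubeLabels.exists_gap (h : CubeLabels L κ) (w : ℕ) (hw : 1 ≤ w) (a b : Site) (O : Pauli p)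
    (hO : IsLogical (cubeGen L) O (cube a w) (cube b w)) (d : Fin 3) (hd : 5 * w < b d - a d) :
    ∃ O', O' - O ∈ stabilizer (cubeGen L) ∧ ∀ u, a d + w ≤ u d → u d < b d → O' u = 0 := by
  obtain ⟨e, f, hde, hdf, hef⟩ : ∃ e f : Fin 3, d ≠ e ∧ d ≠ f ∧ e ≠ f := by
    clear hd
    revert d; decide
  have hcomm : ∀ c, (∀ k, corner c k ∉ cube a w ∧ corner c k ∉ cube b w) →
      Commutes (cubeGen L c) O := by
    intro c hc
    refine hO c ?_ ?_ <;>
    · intro u hu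
      by_contra hne
      obtain ⟨k, rfl⟩ := exists_corner_of_cubeGen_ne_zero hne
      first
        | exact (hc k).1 hu
        | exact (hc k).2 hu
  have hconf : ∀ i c, (∀ k, corner c k d < b d) →
      ((∀ k, corner c k i < a i) ∨ ∀ k, a i + w - 1 < corner c k i) →
      Commutes (cubeGen L c) O := by
    intro i c hc hi
    refine hcomm c fun k => ⟨fun hk => ?_, fun hk => ?_⟩
    · have hki := hk i
      rcases hi with hi | hi
      · have := hi k; omega
      · have := hi k; omega
    · have := hk d
      have := hc k
      omega
  obtain ⟨N, -, hN⟩ := exists_bound O 0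
  -- Below the layer `b d` only the anchor at `a` matters, so generators away from its column
  -- commute. The first confinement starts from bounds given by the finite support; its result
  -- provides the bounds for the second, with the two transverse axes exchanged.
  obtain ⟨O₁, h1, h2⟩ := h.exists_confine hde hdf hef (b d) (a e) (a e + w - 1) (-N) N (by omega) O
    (hconf e) (fun u _ hu => hN u hu f)
  obtain ⟨O₂, h3, h4⟩ := h.exists_confine hdf hde hef.symm (b d) (a f) (a f + w - 1) (a e)
    (a e + w - 1) (by omega) O₁ (fun c hc hi => h.commutes_congr h1 (hconf f c hc hi))
    (fun u hu hu' => (h2 u hu hu').1)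
  have h31 : O₂ - O ∈ stabilizer (cubeGen L) := by
    rw [← sub_add_sub_cancel O₂ O₁ O]; exact add_mem h3 h1
  have hlayers : ∀ c, (∀ k, a d + w ≤ corner c k d ∧ corner c k d < b d) →
      Commutes (cubeGen L c) O := by
    intro c hc
    refine hcomm c fun k => ⟨fun hk => ?_, fun hk => ?_⟩ <;>
    · have := hk d
      have := hc k
      omega
  obtain ⟨O₃, h5, h6⟩ := h.exists_bend hdf hde hef.symm (a d + w) (b d) (a f) (a f + w - 1) (a e)
    (a e + w - 1) O₂ (fun c hc => h.commutes_congr h31 (hlayers c hc)) h4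
  have h53 : O₃ - O ∈ stabilizer (cubeGen L) := by
    rw [← sub_add_sub_cancel O₃ O₂ O]; exact add_mem h5 h31
  obtain ⟨n, rfl⟩ : ∃ n, w = n + 1 := ⟨w - 1, by omega⟩
  -- With `w = n + 1`, the strip has width `2w - 1` and `b d - a d - w > 4w` layers, more than the
  -- `2 (2w - 1)` needed; this is where `5w` comes from.
  refine ⟨O₃, h53, h.eq_zero_on_bend hdf hde hef.symm _ _ (a f) (a e) n (by push_cast at *; omega)
    O₃ (fun c hc => h.commutes_congr h53 (hlayers c hc)) fun u hx hB hu => ?_⟩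
  have := h6 u hx hB hu
  push_cast at this
  refine ⟨⟨⟨by omega, by omega⟩, by omega, by omega⟩, this.2⟩

/-- A nontrivial logical string segment has bounded length. -/
theorem CubeLabels.sub_le_of_isNontrivial (h : CubeLabels L κ) (w : ℕ) (a b : Site) (O : Pauli p)
    (hO : IsLogical (cubeGen L) O (cube a w) (cube b w))
    (hN : IsNontrivial (cubeGen L) O (cube a w) (cube b w)) (d : Fin 3) :
    |b d - a d| ≤ 5 * w := by
  -- Nontriviality applied to `O` itself provides a point in the first cube.
  have hw : 1 ≤ w := by
    obtain ⟨s, hs, -⟩ := hN O (by rw [sub_self]; exact zero_mem _)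
    have := hs d
    omega
  rw [abs_le]
  constructor <;> by_contra! hlt
  · obtain ⟨O', h1, h2⟩ := h.exists_gap w hw b a O (fun c h1 h2 => hO c h2 h1) d (by omega)
    obtain ⟨s, hs, t, ht, hst⟩ := hN O' h1
    have hsd := hs d
    have htd := ht d
    exact not_joinedIn_of_gap O' d (b d + w) (a d) (by omega) h2 (Or.inr (by omega)) hst
  · obtain ⟨O', h1, h2⟩ := h.exists_gap w hw a b O hO d (by omega)
    obtain ⟨s, hs, t, ht, hst⟩ := hN O' h1
    have hsd := hs d
    have htd := ht d
    exact not_joinedIn_of_gap O' d (a d + w) (b d) (by omega) h2 (Or.inl (by omega)) hst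

end Gap

end CubicCode


theorem theorem1 {p : ℕ} [Fact p.Prime] (κ : CubicCode.Family) (α β γ δ : CubicCode.Pair p)
    (hdef : CubicCode.Deformable α β γ δ)
    (hmin : CubicCode.NoMinimalString α β γ δ)
    (hsq : CubicCode.SquaresDiffer α β γ δ) :
    -- a string on a flat or once-bent strip of width `w` and length `l`, logical apart from its
    -- two ends and different from the identity, has length at most `2 w`
    (∀ (d : Fin 3) (k : ℤ) (w l : ℕ) (S : Set CubicCode.Site) (O : CubicCode.Pauli p),
      CubicCode.IsStrip d k w l S → (O.support : Set CubicCode.Site) ⊆ S →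
      CubicCode.IsLogical (CubicCode.gen κ α β γ δ) O
        (CubicCode.before d k) (CubicCode.beyond d (k + l)) →
      O ≠ 0 → l ≤ 2 * w) ∧
    -- there is no string logical operator: a nontrivial logical string segment with cubic anchors
    -- of width `w`, in any direction, has length bounded by a constant multiple of `w`
    (∀ (w : ℕ) (a b : CubicCode.Site) (O : CubicCode.Pauli p),
      CubicCode.IsLogical (CubicCode.gen κ α β γ δ) O (CubicCode.cube a w) (CubicCode.cube b w) →
      CubicCode.IsNontrivial (CubicCode.gen κ α β γ δ) O
        (CubicCode.cube a w) (CubicCode.cube b w) →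
      (∀ i, |b i - a i| ≤ 5 * w) ∧ CubicCode.l1Length a b ≤ 15 * w) := by
  have h := CubicCode.cubeLabels_labels κ hdef hmin hsq
  refine ⟨h.strip_length_le, fun w a b O hO hN => ?_⟩
  have hi := h.sub_le_of_isNontrivial w a b O hO hN
  refine ⟨hi, ?_⟩
  have h0 := hi 0
  have h1 := hi 1
  have h2 := hi 2
  rw [CubicCode.l1Length, Fin.sum_univ_three]
  linarith
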